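/- **Model.** Let $X$ and $Z$ be random vectors in $\mathbb{R}^k$ and $\mathbb{R}^l$, and let $$Y=1[\nu_1(D,X)>\varepsilon_1],\qquad D=1[\nu_2(X,Z)>\varepsilon_2],\qquad Y_d=1[\nu_1(d,X)>\varepsilon_1]\ (d=0,1),$$ where $(Y,D,X,Z)$ is observed and $(\varepsilon_1,\varepsilon_2)$ is not. Write $\Omega_A$ for the support of the law of $A$. Assume: (a) the law of $(\varepsilon_1,\varepsilon_2)$ has a strictly positive density with respect to Lebesgue measure on $\mathbb{R}^2$; (b) $(X,Z)$ is independent of $(\varepsilon_1,\varepsilon_2)$; (c) the conditional distribution of $\nu_2(X,Z)$ given $X$ is almost surely non-degenerate; (d) $\Omega_{X,Z}$ is compact; (e) $\nu_1$ is continuous on $\Omega_{D,X}$ and $\nu_2$ is continuous on $\Omega_{X,Z}$. For $x\in\Omega_X$ let $\mathrm{ATE}(x)=\mathbb{E}[Y_1\mid X=x]-\mathbb{E}[Y_0\mid X=x]$. Let $P=\Pr[D=1\mid X,Z]$, $\underline p=\inf\Omega_P$, $\overline p=\sup\Omega_P$ and $\Omega_{P|x}=\{p:(x,p)\in\Omega_{X,P}\}$.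 Write $\Pr[\,\cdot\mid x,p]$ for $\Pr[\,\cdot\mid X=x,P=p]$, where conditional expectations and probabilities at a point $w$ of the support of the conditioning variable $W$ are the limits as $r\downarrow0$ of those given that $W$ lies in the open ball $B(w,r)$. **SV bounds.** Let $$h(x,x',p,p')=\Pr[Y=1,D=1\mid x',p]-\Pr[Y=1,D=1\mid x',p']-\Pr[Y=1,D=0\mid x,p']+\Pr[Y=1,D=0\mid x,p],$$ and let $H(x,x')=\mathbb{E}[h(x,x',P,P')\mid P>P']$, where in this expectation $P,P'$ are independent with the law of the propensity score. Let $\mathbf X_{0+}(x)=\{x'\in\Omega_X:H(x,x')\ge0\}$, $\mathbf X_{0-}(x)=\{x'\in\Omega_X:H(x,x')\le0\}$, $\mathbf X_{1+}(x)=\{x'\in\Omega_X:H(x',x)\ge0\}$, $\mathbf X_{1-}(x)=\{x'\in\Omega_X:H(x',x)\le0\}$, and $$\begin{aligned}L^{SV}(x)=&\sup_{p\in\Omega_{P|x}}\Big\{\Pr[Y=1,D=1\mid x,p]+\sup_{x'\in\mathbf X_{1+}(x)}\Pr[Y=1,D=0\mid x',p]\Big\}\\&-\inf_{p\in\Omega_{P|x}}\Big\{\Pr[Y=1,D=0\mid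 x,p]+p\inf_{x'\in\mathbf X_{0+}(x)}\Pr[Y=1\mid x',p,D=1]\Big\},\\ U^{SV}(x)=&\inf_{p\in\Omega_{P|x}}\Big\{\Pr[Y=1,D=1\mid x,p]+(1-p)\inf_{x'\in\mathbf X_{1-}(x)}\Pr[Y=1\mid x',p,D=0]\Big\}\\&-\sup_{p\in\Omega_{P|x}}\Big\{\Pr[Y=1,D=0\mid x,p]+\sup_{x'\in\mathbf X_{0-}(x)}\Pr[Y=1,D=1\mid x',p]\Big\},\end{aligned}$$ where the inner suprema and infima run only over those $x'$ with $p\in\Omega_{P|x'}$, $\sup\emptyset=0$ and $\inf\emptyset=1$. Let $\omega^{SV}(x)=U^{SV}(x)-L^{SV}(x)$. **Proposition.** Let the model satisfy (a)–(e) and $\Omega_{X,P}=\Omega_X\times\Omega_P$. *Sharpness.* For every $x\in\Omega_X$ let $\Theta(x)$ be the identified set of $\mathrm{ATE}(x)$: the set of values of $\mathrm{ATE}(x)$ in all models that satisfy (a)–(e) and generate the same law of $(Y,D,X,Z)$. Then the true value $\mathrm{ATE}(x)$ belongs to $\Theta(x)$, and the SV bounds are sharp: $$(L^{SV}(x),U^{SV}(x))\subseteq\Theta(x)\subseteq[L^{SV}(x),U^{SV}(x)].$$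 *Monotonicity.* For every $x\in\Omega_X$, other things equal, (i) $L^{SV}(x)$ weakly increases, (ii) $U^{SV}(x)$ weakly decreases, and hence (iii) $\omega^{SV}(x)$ weakly decreases, as $\underline p$ decreases or as $\overline p$ increases. That is: consider a second model (possibly with other instruments $\tilde Z$, of any dimension, and another function $\tilde\nu_2$) that also satisfies (a)–(e) and the product support condition and has the same $\Omega_X$, the same $\nu_1$ on $\{0,1\}\times\Omega_X$ and the same law of $(\varepsilon_1,\varepsilon_2)$. If its extreme propensity scores satisfy $\underline{\tilde p}\le\underline p$ and $\overline p\le\overline{\tilde p}$, then its SV bounds satisfy $L^{SV}(x)\le\tilde L^{SV}(x)$, $\tilde U^{SV}(x)\le U^{SV}(x)$ and $\tilde\omega^{SV}(x)\le\omega^{SV}(x)$ for every $x\in\Omega_X$. -/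

import Mathlib

open MeasureTheory ProbabilityTheory Set Filter Topology

/-! ### Generic notions -/

/-- The pointwise conditional expectation `E[f | W = w]`, for `w` in the support of `W`:
the limit of the elementary conditional expectations `E[f | W ∈ B(w, r)]` as `r ↓ 0`. It depends
only on the joint law of `(f, W)`, equals the elementary conditional expectation when `w` is an
atom, and equals the value at `w` of the conditional expectation function whenever that function
has a version that is continuous on the support of `W`. -/
noncomputable def condMeanAt {Ω E : Type*} [MeasurableSpace Ω] [PseudoMetricSpace E]
    (μ : Measure Ω) (f : Ω → ℝ) (W : Ω → E) (w : E) : ℝ :=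
  limUnder (𝓝[>] (0 : ℝ)) fun r => ∫ ω, f ω ∂(μ[|W ⁻¹' Metric.ball w r])

/-- The pointwise conditional probability `Pr[A | W = w]`. -/
noncomputable def condProbAt {Ω E : Type*} [MeasurableSpace Ω] [PseudoMetricSpace E]
    (μ : Measure Ω) (A : Set Ω) (W : Ω → E) (w : E) : ℝ :=
  condMeanAt μ (A.indicator fun _ => (1 : ℝ)) W w

/-- The supremum of a set of probabilities, with the convention `sup ∅ = 0`. -/
noncomputable def supZero (S : Set ℝ) : ℝ :=
  open Classical in if S.Nonempty then sSup S else 0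

/-- The infimum of a set of probabilities, with the convention `inf ∅ = 1`. -/
noncomputable def infOne (S : Set ℝ) : ℝ :=
  open Classical in if S.Nonempty then sInf S else 1

/-- `L` and `U` are sharp lower and upper bounds for a parameter with identified set `Θ`:
every value of the identified set lies between `L` and `U`, and every value strictly between `L`
and `U` belongs to the identified set (which is not empty). In particular `L = inf Θ`,
`U = sup Θ`, and the closure of `Θ` is `[L, U]`. -/
def AreSharpBounds (Θ : Set ℝ) (L U : ℝ) : Prop :=
  Θ.Nonempty ∧ Θ ⊆ Icc L U ∧ Ioo L U ⊆ Θ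

/-- Real vectors of dimension `n`. -/
abbrev Vec (n : ℕ) : Type := EuclideanSpace ℝ (Fin n)

/-- Values of the observed data `(Y, D, X, Z)`. -/
abbrev Obs (k l : ℕ) : Type := Fin 2 × Fin 2 × Vec k × Vec l

/-! ### Objects that are computed from the law `π` of the observed data -/

namespace Obs

variable {k l : ℕ}

/-- The outcome `Y`. -/
def Y (o : Obs k l) : Fin 2 := o.1

/-- The treatment `D`. -/
def D (o : Obs k l) : Fin 2 := o.2.1

/-- The covariates `X`. -/
def X (o : Obs k l) : Vec k := o.2.2.1

/-- The instruments `Z`. -/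
def Z (o : Obs k l) : Vec l := o.2.2.2

/-- The support `Ω_X`. -/
noncomputable def suppX (π : Measure (Obs k l)) : Set (Vec k) := (π.map X).support

/-- The propensity score, the random variable `P = Pr[D = 1 | X, Z]`. -/
noncomputable def P (π : Measure (Obs k l)) : Obs k l → ℝ :=
  π[({o | D o = 1} : Set (Obs k l)).indicator (fun _ => (1 : ℝ)) |
    MeasurableSpace.comap (fun o : Obs k l => (X o, Z o)) inferInstance]

/-- The law of `P`. -/
noncomputable def lawP (π : Measure (Obs k l)) : Measure ℝ := π.map (P π)

/-- The support `Ω_P`. -/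
noncomputable def suppP (π : Measure (Obs k l)) : Set ℝ := (lawP π).support

/-- The random vector `(X, P)`. -/
noncomputable def XP (π : Measure (Obs k l)) (o : Obs k l) : Vec k × ℝ := (X o, P π o)

/-- The support `Ω_{X,P}`. -/
noncomputable def suppXP (π : Measure (Obs k l)) : Set (Vec k × ℝ) := (π.map (XP π)).support

/-- The conditional support `Ω_{P|x}`, the section of `Ω_{X,P}` at `x`. -/
def suppPGiven (π : Measure (Obs k l)) (x : Vec k) : Set ℝ := {p | (x, p) ∈ suppXP π}

/-- The support condition `Ω_{X,P} = Ω_X × Ω_P`. -/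
def ProductSupport (π : Measure (Obs k l)) : Prop := suppXP π = suppX π ×ˢ suppP π

/-- The lower extreme value of `Ω_P`. -/
noncomputable def pLow (π : Measure (Obs k l)) : ℝ := sInf (suppP π)

/-- The upper extreme value of `Ω_P`. -/
noncomputable def pHigh (π : Measure (Obs k l)) : ℝ := sSup (suppP π)

/-- `Pr[Y = y, D = d | X = x, P = p]`. -/
noncomputable def prYD (π : Measure (Obs k l)) (y d : Fin 2) (x : Vec k) (p : ℝ) : ℝ :=
  condProbAt π {o | Y o = y ∧ D o = d} (XP π) (x, p)

/-- `Pr[Y = y | X = x, P = p, D = d]`. -/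
noncomputable def prYGivenD (π : Measure (Obs k l)) (y d : Fin 2) (x : Vec k) (p : ℝ) : ℝ :=
  condProbAt (π[|{o | D o = d}]) {o | Y o = y} (XP π) (x, p)

/-- The function `h(x, x', p, p')`. -/
noncomputable def h (π : Measure (Obs k l)) (x x' : Vec k) (p p' : ℝ) : ℝ :=
  prYD π 1 1 x' p - prYD π 1 1 x' p' - prYD π 1 0 x p' + prYD π 1 0 x p

/-- `H(x, x') = E[h(x, x', P, P') | P > P']`, where `P` and `P'` are independent with the law of
the propensity score. -/
noncomputable def H (π : Measure (Obs k l)) (x x' : Vec k) : ℝ :=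
  ∫ q, h π x x' q.1 q.2 ∂(((lawP π).prod (lawP π))[|{q : ℝ × ℝ | q.1 > q.2}])

/-- `𝐗₀₊(x)`. -/
def X0plus (π : Measure (Obs k l)) (x : Vec k) : Set (Vec k) := {x' ∈ suppX π | 0 ≤ H π x x'}

/-- `𝐗₀₋(x)`. -/
def X0minus (π : Measure (Obs k l)) (x : Vec k) : Set (Vec k) := {x' ∈ suppX π | H π x x' ≤ 0}

/-- `𝐗₁₊(x)`. -/
def X1plus (π : Measure (Obs k l)) (x : Vec k) : Set (Vec k) := {x' ∈ suppX π | 0 ≤ H π x' x}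

/-- `𝐗₁₋(x)`. -/
def X1minus (π : Measure (Obs k l)) (x : Vec k) : Set (Vec k) := {x' ∈ suppX π | H π x' x ≤ 0}

/-- The part of a set `S` of covariate values at which the conditional probabilities given
`X = x'` and `P = p` are well defined. -/
def wellDef (π : Measure (Obs k l)) (p : ℝ) (S : Set (Vec k)) : Set (Vec k) :=
  {x' ∈ S | p ∈ suppPGiven π x'}

/-- The SV lower bound `L^{SV}(x)`. -/
noncomputable def lowerSV (π : Measure (Obs k l)) (x : Vec k) : ℝ :=
  supZero ((fun p => prYD π 1 1 x p
      + supZero ((fun x' => prYD π 1 0 x' p) '' wellDef π p (X1plus π x))) '' suppPGiven π x)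
  - infOne ((fun p => prYD π 1 0 x p
      + p * infOne ((fun x' => prYGivenD π 1 1 x' p) '' wellDef π p (X0plus π x)))
        '' suppPGiven π x)

/-- The SV upper bound `U^{SV}(x)`. -/
noncomputable def upperSV (π : Measure (Obs k l)) (x : Vec k) : ℝ :=
  infOne ((fun p => prYD π 1 1 x p
      + (1 - p) * infOne ((fun x' => prYGivenD π 1 0 x' p) '' wellDef π p (X1minus π x)))
        '' suppPGiven π x)
  - supZero ((fun p => prYD π 1 0 x p
      + supZero ((fun x' => prYD π 1 1 x' p) '' wellDef π p (X0minus π x))) '' suppPGiven π x)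

/-- The width `ω^{SV}(x)` of the SV bounds. -/
noncomputable def widthSV (π : Measure (Obs k l)) (x : Vec k) : ℝ := upperSV π x - lowerSV π x

end Obs

/-! ### The joint threshold crossing model -/

universe u v

/-- A joint threshold crossing model: random vectors `X` and `Z`, an unobservable error term
`(ε₁, ε₂)`, and the functions `ν₁`, `ν₂`. Only the values of `ν₁` on `Ω_{D,X}` and of `ν₂` on
`Ω_{X,Z}` matter. -/
structure SVModel (k l : ℕ) where
  Ω : Type u
  [mΩ : MeasurableSpace Ω]
  μ : Measure Ω
  [prob : IsProbabilityMeasure μ]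
  X : Ω → Vec k
  Z : Ω → Vec l
  ε₁ : Ω → ℝ
  ε₂ : Ω → ℝ
  measurable_X : Measurable X
  measurable_Z : Measurable Z
  measurable_ε₁ : Measurable ε₁
  measurable_ε₂ : Measurable ε₂
  ν₁ : Fin 2 → Vec k → ℝ
  ν₂ : Vec k → Vec l → ℝ

namespace SVModel

attribute [instance] SVModel.mΩ SVModel.prob

variable {k l : ℕ}

/-- The potential outcome `Y_d = 1[ν₁(d, X) > ε₁]`. -/
noncomputable def Ypot (M : SVModel.{u} k l) (d : Fin 2) (ω : M.Ω) : Fin 2 :=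
  if M.ν₁ d (M.X ω) > M.ε₁ ω then 1 else 0

/-- The treatment `D = 1[ν₂(X, Z) > ε₂]`. -/
noncomputable def D (M : SVModel.{u} k l) (ω : M.Ω) : Fin 2 :=
  if M.ν₂ (M.X ω) (M.Z ω) > M.ε₂ ω then 1 else 0

/-- The outcome `Y = 1[ν₁(D, X) > ε₁]`. -/
noncomputable def Y (M : SVModel.{u} k l) (ω : M.Ω) : Fin 2 :=
  if M.ν₁ (M.D ω) (M.X ω) > M.ε₁ ω then 1 else 0

/-- The law of the observed data `(Y, D, X, Z)`. -/
noncomputable def obsLaw (M : SVModel.{u} k l) : Measure (Obs k l) :=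
  M.μ.map fun ω => (M.Y ω, M.D ω, M.X ω, M.Z ω)

/-- The law of the error term `(ε₁, ε₂)`. -/
noncomputable def errLaw (M : SVModel.{u} k l) : Measure (ℝ × ℝ) :=
  M.μ.map fun ω => (M.ε₁ ω, M.ε₂ ω)

/-- The support `Ω_X`. -/
noncomputable def suppX (M : SVModel.{u} k l) : Set (Vec k) := (M.μ.map M.X).support

/-- The support `Ω_{X,Z}`. -/
noncomputable def suppXZ (M : SVModel.{u} k l) : Set (Vec k × Vec l) :=
  (M.μ.map fun ω => (M.X ω, M.Z ω)).support

/-- The support `Ω_{D,X}`. -/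
noncomputable def suppDX (M : SVModel.{u} k l) : Set (Fin 2 × Vec k) :=
  (M.μ.map fun ω => (M.D ω, M.X ω)).support

/-- `ATE(x) = E[Y₁ | X = x] - E[Y₀ | X = x]`. -/
noncomputable def ATE (M : SVModel.{u} k l) (x : Vec k) : ℝ :=
  condMeanAt M.μ (fun ω => ((M.Ypot 1 ω : ℕ) : ℝ)) M.X x
    - condMeanAt M.μ (fun ω => ((M.Ypot 0 ω : ℕ) : ℝ)) M.X x

/-- The assumptions on the joint threshold crossing model. -/
structure Assumptions (M : SVModel.{u} k l) : Prop where
  /-- The law of `(ε₁, ε₂)` has a strictly positive density with respect to Lebesgue measure. -/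
  density : ∃ f : ℝ × ℝ → ENNReal, Measurable f ∧ (∀ e, 0 < f e) ∧
    M.errLaw = (volume : Measure (ℝ × ℝ)).withDensity f
  /-- `(X, Z)` is independent of `(ε₁, ε₂)`. -/
  indep : IndepFun (fun ω => (M.X ω, M.Z ω)) (fun ω => (M.ε₁ ω, M.ε₂ ω)) M.μ
  /-- The conditional distribution of `ν₂(X, Z)` given `X` is non-degenerate (almost surely). -/
  nondegenerate : ∀ᵐ x ∂(M.μ.map M.X), ∀ c : ℝ,
    condDistrib (fun ω => M.ν₂ (M.X ω) (M.Z ω)) M.X M.μ x ≠ Measure.dirac c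
  /-- The support of `(X, Z)` is compact. -/
  compact : IsCompact M.suppXZ
  /-- `ν₁` is continuous on `Ω_{D,X}`. -/
  continuous_ν₁ : ContinuousOn (fun q : Fin 2 × Vec k => M.ν₁ q.1 q.2) M.suppDX
  /-- `ν₂` is continuous on `Ω_{X,Z}`. -/
  continuous_ν₂ : ContinuousOn (fun q : Vec k × Vec l => M.ν₂ q.1 q.2) M.suppXZ

end SVModel

/-- The identified set of `ATE(x)` when the observed data have law `π`: all values of `ATE(x)` in
models that satisfy the assumptions and generate the law `π`. Everything depends only on the
joint law of `(X, Z, ε₁, ε₂)`, so that probability spaces in `Type` suffice. -/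
def identifiedSet {k l : ℕ} (π : Measure (Obs k l)) (x : Vec k) : Set ℝ :=
  {s | ∃ M : SVModel.{0} k l, M.Assumptions ∧ M.obsLaw = π ∧ M.ATE x = s}

/-! ### Pointwise conditional means -/

section CondMean

variable {Ω E : Type*} [MeasurableSpace Ω] [PseudoMetricSpace E]

/-! Let F be the distribution function of ε₂ and V = F(ε₂) its rank. The positive density makes F
strictly increasing and continuous, so P = F(ν₂(X,Z)) and, almost surely, D = 1 exactly when V < P.
Let low(p) and high(p) be the laws of ε₁ on {V < p} and on {V ≥ p} (`lowPart`, `highPart`), and put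
t_d = ν₁(d,x). By independence, Pr[Y=1,D=1|x,p] = low(p)(-∞,t₁) and Pr[Y=1,D=0|x,p] =
high(p)(-∞,t₀). Both are continuous on the support of (X,P), which gives the pointwise conditional
probabilities their meaning.

Since low(p) + high(p) does not depend on p, H(x,x') averages the mass of ε₁ between ν₁(0,x) and
ν₁(1,x') over rank bands, with a sign. The positive density makes H(x,x') have the sign of ν₁(1,x')
- ν₁(0,x) (`H_nonneg_iff`, `H_nonpos_iff`). The four sets of covariates are therefore sublevel and
superlevel sets of ν₁. By compactness the inner suprema and infima are masses of the largest
observable half-line inside (-∞,t_d) and the smallest one around it (`innerRay`, `outerRay`). The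
expressions to be optimised over p are monotone, because a change of p moves a band of ranks from
one of two nested sets to the other. The optima therefore sit at the extreme scores, which gives the
closed forms `lowerSV_eq` and `upperSV_eq`.

Validity and monotonicity are read off from these forms. The ATE is the same expression with the
half-line itself in place of the inner or outer ray; a wider score range moves more rank bands to
the favourable set.

For sharpness, ranks V ≥ p̄ never occur with D = 1 and ranks V < p̲ never with D = 0. On the first
region only the order of ε₁ relative to the values ν₁(0,·) is visible, on the second only that
relative to ν₁(1,·). A piecewise affine map that is the identity outside a gap between visible
thresholds moves the mass below t₁ (on the high region) or t₀ (on the low region) to any value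
strictly between the inner and outer masses (`exists_rearrangement`). Such a map keeps the error law
equivalent to Lebesgue measure, so the altered model still satisfies the assumptions and generates
the same data, while its ATE runs through the open interval between the bounds. -/

theorem measureReal_preimage_ball_pos [MeasurableSpace E] [OpensMeasurableSpace E]
    {μ : Measure Ω} [IsFiniteMeasure μ] {W : Ω → E} (hW : Measurable W) {w : E}
    (hw : w ∈ (μ.map W).support) {r : ℝ} (hr : 0 < r) :
    0 < μ.real (W ⁻¹' Metric.ball w r) := by
  have h := (Measure.mem_support_iff_forall w).1 hw _ (Metric.ball_mem_nhds w hr)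
  rw [Measure.map_apply hW Metric.isOpen_ball.measurableSet] at h
  exact ENNReal.toReal_pos h.ne' (measure_ne_top _ _)

/-- If `f` has the same integral as `g ∘ W` over the preimages of balls around `w`, then the means
of `f` over these preimages converge to `g w`. -/
theorem tendsto_setIntegral_ball_div [MeasurableSpace E] [OpensMeasurableSpace E]
    [HereditarilyLindelofSpace E] {μ : Measure Ω} [IsFiniteMeasure μ] {f : Ω → ℝ} {W : Ω → E}
    {g : E → ℝ} {w : E} (hW : Measurable W) (hw : w ∈ (μ.map W).support)
    (hg : ContinuousWithinAt g (μ.map W).support w) (hgi : Integrable (fun ω => g (W ω)) μ)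
    (hfg : ∀ r, ∫ ω in W ⁻¹' Metric.ball w r, f ω ∂μ
      = ∫ ω in W ⁻¹' Metric.ball w r, g (W ω) ∂μ) :
    Tendsto (fun r => (∫ ω in W ⁻¹' Metric.ball w r, f ω ∂μ) / μ.real (W ⁻¹' Metric.ball w r))
      (𝓝[>] 0) (𝓝 (g w)) := by
  have hsupp : ∀ᵐ ω ∂μ, W ω ∈ (μ.map W).support :=
    ae_of_ae_map hW.aemeasurable Measure.support_mem_ae
  rw [Metric.tendsto_nhds]
  intro ε hε
  obtain ⟨δ, hδ, hδg⟩ := Metric.continuousWithinAt_iff.1 hg (ε / 2) (half_pos hε)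
  filter_upwards [Ioo_mem_nhdsGT hδ] with r hr
  have hpos := measureReal_preimage_ball_pos hW hw hr.1
  have hms : MeasurableSet (W ⁻¹' Metric.ball w r) := hW Metric.isOpen_ball.measurableSet
  have hb : ‖∫ ω in W ⁻¹' Metric.ball w r, (g (W ω) - g w) ∂μ‖
      ≤ ε / 2 * μ.real (W ⁻¹' Metric.ball w r) := by
    refine norm_setIntegral_le_of_norm_le_const_ae (measure_lt_top _ _) ?_
    rw [ae_restrict_iff' hms]
    filter_upwards [hsupp] with ω h1 h2
    exact (hδg h1 (lt_trans h2 hr.2)).le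
  rw [integral_sub hgi.integrableOn (integrable_const _), setIntegral_const, smul_eq_mul,
    ← hfg r] at hb
  rw [Real.dist_eq, div_sub' hpos.ne', abs_div, abs_of_pos hpos, div_lt_iff₀ hpos]
  refine lt_of_le_of_lt hb ?_
  gcongr
  linarith

theorem integral_cond_eq_div (μ : Measure Ω) (f : Ω → ℝ) (s : Set Ω) :
    ∫ ω, f ω ∂(μ[|s]) = (∫ ω in s, f ω ∂μ) / μ.real s := by
  rw [ProbabilityTheory.cond, integral_smul_measure, ENNReal.toReal_inv, smul_eq_mul, div_eq_inv_mul,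
    Measure.real]

theorem condMeanAt_eq_of_tendsto {μ : Measure Ω} {f : Ω → ℝ} {W : Ω → E} {w : E} {a : ℝ}
    (h : Tendsto (fun r => (∫ ω in W ⁻¹' Metric.ball w r, f ω ∂μ)
      / μ.real (W ⁻¹' Metric.ball w r)) (𝓝[>] 0) (𝓝 a)) :
    condMeanAt μ f W w = a := by
  simp only [condMeanAt, integral_cond_eq_div]
  exact h.limUnder_eq

/-- Pointwise conditional probability given an event, as a ratio of densities. -/
theorem condProbAt_cond_eq_div [MeasurableSpace E] [OpensMeasurableSpace E]
    {μ : Measure Ω} [IsFiniteMeasure μ] {A D : Set Ω} (hA : MeasurableSet A) (hD : MeasurableSet D)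
    {W : Ω → E} (hW : Measurable W) {w : E} (hw : w ∈ (μ.map W).support) {a d : ℝ} (hd : d ≠ 0)
    (hAD : Tendsto (fun r => (∫ ω in W ⁻¹' Metric.ball w r,
        (A ∩ D).indicator (fun _ => (1 : ℝ)) ω ∂μ) / μ.real (W ⁻¹' Metric.ball w r))
      (𝓝[>] 0) (𝓝 a))
    (hDD : Tendsto (fun r => (∫ ω in W ⁻¹' Metric.ball w r,
        D.indicator (fun _ => (1 : ℝ)) ω ∂μ) / μ.real (W ⁻¹' Metric.ball w r))
      (𝓝[>] 0) (𝓝 d)) :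
    condProbAt (μ[|D]) A W w = a / d := by
  rw [condProbAt, condMeanAt]
  refine Tendsto.limUnder_eq ((hAD.div hDD hd).congr' ?_)
  filter_upwards [self_mem_nhdsWithin] with r hr
  have hB : MeasurableSet (W ⁻¹' Metric.ball w r) := hW Metric.isOpen_ball.measurableSet
  have hpos := measureReal_preimage_ball_pos hW hw hr
  -- Conditioning on the event and then on the ball is conditioning on their intersection, so the
  -- mass of the ball cancels from the two ratios.
  rw [cond_cond_eq_cond_inter hD hB, integral_cond_eq_div, Pi.div_apply,
    div_div_div_cancel_right₀ hpos.ne', setIntegral_indicator (hA.inter hD),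
    setIntegral_indicator hD, setIntegral_indicator hA]
  simp only [setIntegral_const, smul_eq_mul, mul_one]
  rw [inter_comm D, inter_comm A, inter_assoc]

end CondMean

/-! ### Suprema and infima with conventions -/

theorem supZero_image_eq {α : Type*} {S : Set α} {f : α → ℝ} {a : α} (ha : a ∈ S)
    (h : ∀ b ∈ S, f b ≤ f a) : supZero (f '' S) = f a := by
  rw [supZero, if_pos ⟨f a, mem_image_of_mem f ha⟩]
  exact IsGreatest.csSup_eq ⟨mem_image_of_mem f ha, by rintro _ ⟨b, hb, rfl⟩; exact h b hb⟩

theorem infOne_image_eq {α : Type*} {S : Set α} {f : α → ℝ} {a : α} (ha : a ∈ S)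
    (h : ∀ b ∈ S, f a ≤ f b) : infOne (f '' S) = f a := by
  rw [infOne, if_pos ⟨f a, mem_image_of_mem f ha⟩]
  exact IsLeast.csInf_eq ⟨mem_image_of_mem f ha, by rintro _ ⟨b, hb, rfl⟩; exact h b hb⟩

/-- By compactness the largest half-line is attained and equals the union. For empty `K` the
convention sup ∅ = 0 is the mass of the empty union. -/
theorem supZero_image_measureReal_Iio {E : Type*} [TopologicalSpace E] {K : Set E}
    (hK : IsCompact K) {f : E → ℝ} (hf : ContinuousOn f K) (κ : Measure ℝ) [IsFiniteMeasure κ] :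
    supZero ((fun x => κ.real (Iio (f x))) '' K) = κ.real (⋃ x ∈ K, Iio (f x)) := by
  rcases K.eq_empty_or_nonempty with rfl | hne
  · simp [supZero]
  · obtain ⟨a, ha, hmax⟩ := hK.exists_isMaxOn hne hf
    rw [supZero_image_eq ha fun b hb => measureReal_mono (Iio_subset_Iio (hmax hb))]
    congr 1
    refine Subset.antisymm (subset_iUnion₂_of_subset a ha subset_rfl) (iUnion₂_subset fun b hb => ?_)
    exact Iio_subset_Iio (hmax hb)

/-- By compactness the smallest half-line is attained and equals the intersection. For empty `K` the
convention inf ∅ = 1 gives the total mass `c`, that of the empty intersection. -/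
theorem mul_infOne_image_measureReal_Iio_div {E : Type*} [TopologicalSpace E] {K : Set E}
    (hK : IsCompact K) {f : E → ℝ} (hf : ContinuousOn f K) (κ : Measure ℝ) [IsFiniteMeasure κ]
    {c : ℝ} (hc : 0 < c) (hκ : κ.real univ = c) :
    c * infOne ((fun x => κ.real (Iio (f x)) / c) '' K) = κ.real (⋂ x ∈ K, Iio (f x)) := by
  rcases K.eq_empty_or_nonempty with rfl | hne
  · simp [infOne, hκ]
  · obtain ⟨a, ha, hmin⟩ := hK.exists_isMinOn hne hf
    rw [infOne_image_eq ha fun b hb => div_le_div_of_nonneg_right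
      (measureReal_mono (Iio_subset_Iio (hmin hb))) hc.le, mul_div_cancel₀ _ hc.ne']
    congr 1
    refine Subset.antisymm (subset_iInter₂ fun b hb => ?_) (iInter₂_subset a ha)
    exact Iio_subset_Iio (hmin hb)

/-! ### Distribution functions of atomless measures -/

/-- Dominated convergence for indicators. One statement serves both continuity at a point and the
limits at ±∞. -/
theorem tendsto_measureReal_Iio_of_ae {κ : Measure ℝ} [IsFiniteMeasure κ] {l : Filter ℝ}
    [l.IsCountablyGenerated] {S : Set ℝ} (hS : MeasurableSet S)
    (h : ∀ᵐ x ∂κ, ∀ᶠ t in l, (x < t ↔ x ∈ S)) :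
    Tendsto (fun t => κ.real (Iio t)) l (𝓝 (κ.real S)) := by
  have hi : ∀ A : Set ℝ, MeasurableSet A → κ.real A = ∫ x, A.indicator (fun _ => (1 : ℝ)) x ∂κ :=
    fun A hA => by simp [integral_indicator_const _ hA]
  simp only [hi _ measurableSet_Iio, hi S hS]
  refine tendsto_integral_filter_of_dominated_convergence (fun _ => 1)
    (Eventually.of_forall fun t =>
      ((measurable_const.indicator measurableSet_Iio).aestronglyMeasurable))
    (Eventually.of_forall fun t => Eventually.of_forall fun x => ?_) (integrable_const _) ?_
  · by_cases hx : x ∈ Iio t <;> simp [hx]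
  · filter_upwards [h] with x hx
    refine tendsto_const_nhds.congr' ?_
    filter_upwards [hx] with t ht
    by_cases hxS : x ∈ S
    · simp [hxS, ht.2 hxS]
    · simp [hxS, mt ht.1 hxS]

theorem continuous_measureReal_Iio (κ : Measure ℝ) [IsFiniteMeasure κ] [NullSingletonClass κ] :
    Continuous fun t => κ.real (Iio t) := by
  refine continuous_iff_continuousAt.2 fun t₀ => tendsto_measureReal_Iio_of_ae measurableSet_Iio ?_
  have : ∀ᵐ x ∂κ, x ≠ t₀ := by simp [ae_iff]
  filter_upwards [this] with x hx
  rcases lt_or_gt_of_ne hx with h | h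
  · filter_upwards [Ioi_mem_nhds h] with t ht
    exact ⟨fun _ => h, fun _ => ht⟩
  · filter_upwards [Iio_mem_nhds h] with t ht
    exact ⟨fun h' => absurd h' (not_lt.2 (le_of_lt ht)), fun h' => absurd h' (not_lt.2 h.le)⟩

theorem tendsto_measureReal_Iio_atBot (κ : Measure ℝ) [IsFiniteMeasure κ] :
    Tendsto (fun t => κ.real (Iio t)) atBot (𝓝 0) := by
  simpa using! tendsto_measureReal_Iio_of_ae (κ := κ) (l := atBot) MeasurableSet.empty
    (Eventually.of_forall fun x => by
      filter_upwards [eventually_le_atBot x] with t ht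
      simpa using ht)

theorem tendsto_measureReal_Iio_atTop (κ : Measure ℝ) [IsFiniteMeasure κ] :
    Tendsto (fun t => κ.real (Iio t)) atTop (𝓝 (κ.real univ)) :=
  tendsto_measureReal_Iio_of_ae MeasurableSet.univ
    (Eventually.of_forall fun x => by
      filter_upwards [eventually_gt_atTop x] with t ht
      simpa using ht)

/-! ### The law of the error terms -/

/-- The distribution function of the second error term. -/
noncomputable def errCdf (lam : Measure (ℝ × ℝ)) (t : ℝ) : ℝ := lam.real {e | e.2 < t}

/-- The law of the first error term on the event that the rank of the second one is below `p`. -/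
noncomputable def lowPart (lam : Measure (ℝ × ℝ)) (p : ℝ) : Measure ℝ :=
  (lam.restrict {e | errCdf lam e.2 < p}).map Prod.fst

/-- The law of the first error term on the event that the rank of the second one is at least `p`. -/
noncomputable def highPart (lam : Measure (ℝ × ℝ)) (p : ℝ) : Measure ℝ :=
  (lam.restrict {e | p ≤ errCdf lam e.2}).map Prod.fst

section ErrorLaw

variable {lam : Measure (ℝ × ℝ)}

theorem monotone_errCdf [IsFiniteMeasure lam] : Monotone (errCdf lam) := fun _ _ h =>
  measureReal_mono fun _ he => lt_of_lt_of_le he h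

theorem measurable_errCdf [IsFiniteMeasure lam] : Measurable (errCdf lam) :=
  monotone_errCdf.measurable

theorem measurableSet_errCdf_lt [IsFiniteMeasure lam] (p : ℝ) :
    MeasurableSet {e : ℝ × ℝ | errCdf lam e.2 < p} :=
  measurableSet_lt (measurable_errCdf.comp measurable_snd) measurable_const

theorem measurableSet_le_errCdf [IsFiniteMeasure lam] (p : ℝ) :
    MeasurableSet {e : ℝ × ℝ | p ≤ errCdf lam e.2} :=
  measurableSet_le measurable_const (measurable_errCdf.comp measurable_snd)

instance [IsFiniteMeasure lam] (p : ℝ) : IsFiniteMeasure (lowPart lam p) := by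
  unfold lowPart; infer_instance

instance [IsFiniteMeasure lam] (p : ℝ) : IsFiniteMeasure (highPart lam p) := by
  unfold highPart; infer_instance

theorem lowPart_real_apply {p : ℝ} {A : Set ℝ} (hA : MeasurableSet A) :
    (lowPart lam p).real A = lam.real {e | e.1 ∈ A ∧ errCdf lam e.2 < p} := by
  rw [lowPart, map_measureReal_apply measurable_fst hA,
    measureReal_restrict_apply (measurable_fst hA)]
  rfl

theorem highPart_real_apply {p : ℝ} {A : Set ℝ} (hA : MeasurableSet A) :
    (highPart lam p).real A = lam.real {e | e.1 ∈ A ∧ p ≤ errCdf lam e.2} := by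
  rw [highPart, map_measureReal_apply measurable_fst hA,
    measureReal_restrict_apply (measurable_fst hA)]
  rfl

theorem measure_fst_eq_zero (hac : lam ≪ volume) (t : ℝ) : lam {e | e.1 = t} = 0 := by
  refine hac ?_
  have : {e : ℝ × ℝ | e.1 = t} = {t} ×ˢ univ := by ext e; simp
  rw [this, Measure.volume_eq_prod, Measure.prod_prod]
  simp

theorem measure_snd_eq_zero (hac : lam ≪ volume) (t : ℝ) : lam {e | e.2 = t} = 0 := by
  refine hac ?_
  have : {e : ℝ × ℝ | e.2 = t} = univ ×ˢ {t} := by ext e; simp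
  rw [this, Measure.volume_eq_prod, Measure.prod_prod]
  simp

theorem nullSingletonClass_map_fst_restrict (hac : lam ≪ volume) (B : Set (ℝ × ℝ)) : NullSingletonClass ((lam.restrict B).map Prod.fst) := by
  refine ⟨fun t => ?_⟩
  rw [Measure.map_apply measurable_fst (measurableSet_singleton t)]
  exact Measure.absolutelyContinuous_of_le Measure.restrict_le_self (measure_fst_eq_zero hac t)

variable [IsProbabilityMeasure lam]

theorem lowPart_real_add_highPart_real (p : ℝ) {A : Set ℝ} (hA : MeasurableSet A) :
    (lowPart lam p).real A + (highPart lam p).real A = (lam.map Prod.fst).real A := by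
  rw [lowPart_real_apply hA, highPart_real_apply hA, map_measureReal_apply measurable_fst hA,
    ← measureReal_inter_add_sdiff (s := Prod.fst ⁻¹' A) (measurableSet_errCdf_lt (lam := lam) p)]
  congr 2
  ext e
  simp

theorem lowPart_real_eq_add {p p' : ℝ} (h : p ≤ p') {A : Set ℝ} (hA : MeasurableSet A) :
    (lowPart lam p').real A = (lowPart lam p).real A
      + lam.real {e | e.1 ∈ A ∧ p ≤ errCdf lam e.2 ∧ errCdf lam e.2 < p'} := by
  rw [lowPart_real_apply hA, lowPart_real_apply hA,
    ← measureReal_inter_add_sdiff (measurableSet_errCdf_lt (lam := lam) p)]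
  congr 2
  · ext e
    simp only [mem_inter_iff, mem_ofPred_eq]
    exact ⟨fun h' => ⟨h'.1.1, h'.2⟩, fun h' => ⟨⟨h'.1, h'.2.trans_le h⟩, h'.2⟩⟩
  · ext e
    simp only [Set.mem_sdiff, mem_ofPred_eq, not_lt]
    tauto

theorem lowPart_real_mono {p p' : ℝ} (h : p ≤ p') {A : Set ℝ} (hA : MeasurableSet A) :
    (lowPart lam p).real A ≤ (lowPart lam p').real A := by
  rw [lowPart_real_eq_add h hA]
  exact le_add_of_nonneg_right measureReal_nonneg

theorem lowPart_real_sub_mono {p p' : ℝ} (h : p ≤ p') {A B : Set ℝ} (hA : MeasurableSet A)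
    (hB : MeasurableSet B) (hAB : A ⊆ B) :
    (lowPart lam p').real A - (lowPart lam p).real A
      ≤ (lowPart lam p').real B - (lowPart lam p).real B := by
  rw [lowPart_real_eq_add h hA, lowPart_real_eq_add h hB, add_sub_cancel_left, add_sub_cancel_left]
  exact measureReal_mono fun e he => ⟨hAB he.1, he.2⟩

/-- Moving weight from the high to the low part increases the mixed mass of a larger low set and a
smaller high set. -/
theorem lowPart_add_highPart_mono {J K : Set ℝ} (hJ : MeasurableSet J) (hK : MeasurableSet K)
    (hKJ : K ⊆ J) {p p' : ℝ} (h : p ≤ p') :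
    (lowPart lam p).real J + (highPart lam p).real K
      ≤ (lowPart lam p').real J + (highPart lam p').real K := by
  have h1 := lowPart_real_sub_mono (lam := lam) h hK hJ hKJ
  have h2 := lowPart_real_add_highPart_real (lam := lam) p hK
  have h3 := lowPart_real_add_highPart_real (lam := lam) p' hK
  linarith

/-- The ranks between `p` and `p'` pass from counting the larger set `K` to counting the smaller set
`J`. -/
theorem lowPart_add_highPart_anti {J K : Set ℝ} (hJ : MeasurableSet J) (hK : MeasurableSet K)
    (hJK : J ⊆ K) {p p' : ℝ} (h : p ≤ p') :
    (lowPart lam p').real J + (highPart lam p').real K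
      ≤ (lowPart lam p).real J + (highPart lam p).real K := by
  have h1 := lowPart_real_sub_mono (lam := lam) h hJ hK hJK
  have h2 := lowPart_real_add_highPart_real (lam := lam) p hK
  have h3 := lowPart_real_add_highPart_real (lam := lam) p' hK
  linarith

theorem continuous_errCdf (hac : lam ≪ volume) : Continuous (errCdf lam) := by
  have : NullSingletonClass (lam.map Prod.snd) := ⟨fun t => by
    rw [Measure.map_apply measurable_snd (measurableSet_singleton t)]
    exact measure_snd_eq_zero hac t⟩
  refine (continuous_measureReal_Iio (lam.map Prod.snd)).congr fun t => ?_
  rw [map_measureReal_apply measurable_snd measurableSet_Iio]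
  rfl

theorem measureReal_pos_of_isOpen (hca : volume ≪ lam) {U A : Set (ℝ × ℝ)} (hU : IsOpen U) (hne : U.Nonempty)
    (hUA : U ⊆ A) : 0 < lam.real A := by
  have : 0 < lam U := by
    rw [pos_iff_ne_zero]
    intro h0
    exact (hU.measure_pos volume hne).ne' (hca h0)
  exact ENNReal.toReal_pos (this.trans_le (measure_mono hUA)).ne' (measure_ne_top _ _)

theorem strictMono_errCdf (hca : volume ≪ lam) : StrictMono (errCdf lam) := by
  intro a b hab
  have hpos : 0 < lam.real {e | a ≤ e.2 ∧ e.2 < b} := by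
    refine measureReal_pos_of_isOpen hca (U := univ ×ˢ Ioo a b) (isOpen_univ.prod isOpen_Ioo)
      (univ_nonempty.prod (nonempty_Ioo.2 hab)) ?_
    rintro e ⟨-, he⟩
    exact ⟨he.1.le, he.2⟩
  have hs : errCdf lam b = errCdf lam a + lam.real {e | a ≤ e.2 ∧ e.2 < b} := by
    rw [errCdf, errCdf, ← measureReal_inter_add_sdiff
      (measurableSet_lt measurable_snd measurable_const : MeasurableSet {e : ℝ × ℝ | e.2 < a})]
    congr 2
    · ext e
      simp only [mem_inter_iff, mem_ofPred_eq]
      exact ⟨fun h => h.2, fun h => ⟨h.trans hab, h⟩⟩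
    · ext e
      simp only [Set.mem_sdiff, mem_ofPred_eq, not_lt]
      tauto
  linarith

theorem errCdf_pos (hca : volume ≪ lam) (t : ℝ) : 0 < errCdf lam t :=
  lt_of_le_of_lt measureReal_nonneg (strictMono_errCdf hca (sub_one_lt t))

theorem errCdf_lt_one (hca : volume ≪ lam) (t : ℝ) : errCdf lam t < 1 :=
  lt_of_lt_of_le (strictMono_errCdf hca (lt_add_one t)) measureReal_le_one

theorem lowPart_errCdf_univ (hca : volume ≪ lam) (q : ℝ) : (lowPart lam (errCdf lam q)).real univ = errCdf lam q := by
  rw [lowPart_real_apply MeasurableSet.univ]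
  simp only [mem_univ, true_and, (strictMono_errCdf hca).lt_iff_lt]
  rfl

/-- The difference of the two sides is the mass of a rank band with ε₁ in `[t, t')`; it contains an
open rectangle, which has positive mass. This is what fixes the sign of H. -/
theorem lowPart_real_sub_strictMono (hca : volume ≪ lam) {q q' t t' : ℝ} (hq : q < q') (ht : t < t') :
    (lowPart lam (errCdf lam q')).real (Iio t) - (lowPart lam (errCdf lam q)).real (Iio t)
      < (lowPart lam (errCdf lam q')).real (Iio t')
        - (lowPart lam (errCdf lam q)).real (Iio t') := by
  have hle := monotone_errCdf (lam := lam) hq.le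
  rw [lowPart_real_eq_add hle measurableSet_Iio, lowPart_real_eq_add hle measurableSet_Iio,
    add_sub_cancel_left, add_sub_cancel_left]
  have hm : MeasurableSet {e : ℝ × ℝ | e.1 ∈ Iio t} := measurable_fst measurableSet_Iio
  rw [← measureReal_inter_add_sdiff
    (s := {e : ℝ × ℝ | e.1 ∈ Iio t' ∧ errCdf lam q ≤ errCdf lam e.2
      ∧ errCdf lam e.2 < errCdf lam q'}) hm]
  have hpos : 0 < lam.real ({e | e.1 ∈ Iio t' ∧ errCdf lam q ≤ errCdf lam e.2
      ∧ errCdf lam e.2 < errCdf lam q'} \ {e | e.1 ∈ Iio t}) := by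
    refine measureReal_pos_of_isOpen hca (U := Ioo t t' ×ˢ Ioo q q') (isOpen_Ioo.prod isOpen_Ioo)
      ((nonempty_Ioo.2 ht).prod (nonempty_Ioo.2 hq)) ?_
    rintro e ⟨h1, h2⟩
    exact ⟨⟨h1.2, (strictMono_errCdf hca h2.1).le, strictMono_errCdf hca h2.2⟩, not_lt.2 h1.1.le⟩
  have heq : {e : ℝ × ℝ | e.1 ∈ Iio t' ∧ errCdf lam q ≤ errCdf lam e.2
      ∧ errCdf lam e.2 < errCdf lam q'} ∩ {e | e.1 ∈ Iio t}
      = {e | e.1 ∈ Iio t ∧ errCdf lam q ≤ errCdf lam e.2 ∧ errCdf lam e.2 < errCdf lam q'} := by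
    ext e
    simp only [mem_inter_iff, mem_ofPred_eq, mem_Iio]
    exact ⟨fun h => ⟨h.2, h.1.2⟩, fun h => ⟨⟨h.1.trans ht, h.2⟩, h.1⟩⟩
  rw [heq]
  linarith

theorem continuous_map_fst_Iio (hac : lam ≪ volume) : Continuous fun t => (lam.map Prod.fst).real (Iio t) := by
  have := nullSingletonClass_map_fst_restrict hac univ
  rw [Measure.restrict_univ] at this
  exact continuous_measureReal_Iio _

theorem continuous_lowPart_Iio (hac : lam ≪ volume) (p : ℝ) : Continuous fun t => (lowPart lam p).real (Iio t) := by
  have : NullSingletonClass (lowPart lam p) := nullSingletonClass_map_fst_restrict hac _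
  exact continuous_measureReal_Iio _

theorem abs_lowPart_real_sub_le {p p' : ℝ} {A : Set ℝ} (hA : MeasurableSet A) :
    |(lowPart lam p').real A - (lowPart lam p).real A|
      ≤ |(lowPart lam p').real univ - (lowPart lam p).real univ| := by
  rcases le_total p p' with h | h
  · rw [abs_of_nonneg (sub_nonneg.2 (lowPart_real_mono h hA)),
      abs_of_nonneg (sub_nonneg.2 (lowPart_real_mono h MeasurableSet.univ))]
    exact lowPart_real_sub_mono h hA MeasurableSet.univ (subset_univ _)
  · rw [abs_sub_comm, abs_sub_comm ((lowPart lam p').real univ),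
      abs_of_nonneg (sub_nonneg.2 (lowPart_real_mono h hA)),
      abs_of_nonneg (sub_nonneg.2 (lowPart_real_mono h MeasurableSet.univ))]
    exact lowPart_real_sub_mono h hA MeasurableSet.univ (subset_univ _)

/-- Where the rank is uniform, replacing `p₀` by `p` changes the mass of every set by at most |p -
p₀|. This uniformity in the threshold turns separate continuity into joint continuity. -/
theorem continuousOn_lowPart (hac : lam ≪ volume) :
    ContinuousOn (fun a : ℝ × ℝ => (lowPart lam a.2).real (Iio a.1))
      {a | (lowPart lam a.2).real univ = a.2} := by
  rintro ⟨t₀, p₀⟩ h₀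
  have hc : Tendsto (fun a : ℝ × ℝ => (lowPart lam p₀).real (Iio a.1) + |a.2 - p₀|)
      (𝓝 (t₀, p₀)) (𝓝 ((lowPart lam p₀).real (Iio t₀))) := by
    have : Continuous fun a : ℝ × ℝ => (lowPart lam p₀).real (Iio a.1) + |a.2 - p₀| :=
      ((continuous_lowPart_Iio hac p₀).comp continuous_fst).add (by fun_prop)
    simpa using! this.tendsto (t₀, p₀)
  have hc' : Tendsto (fun a : ℝ × ℝ => (lowPart lam p₀).real (Iio a.1) - |a.2 - p₀|)
      (𝓝 (t₀, p₀)) (𝓝 ((lowPart lam p₀).real (Iio t₀))) := by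
    have : Continuous fun a : ℝ × ℝ => (lowPart lam p₀).real (Iio a.1) - |a.2 - p₀| :=
      ((continuous_lowPart_Iio hac p₀).comp continuous_fst).sub (by fun_prop)
    simpa using! this.tendsto (t₀, p₀)
  have key : ∀ a ∈ {a : ℝ × ℝ | (lowPart lam a.2).real univ = a.2},
      |(lowPart lam a.2).real (Iio a.1) - (lowPart lam p₀).real (Iio a.1)| ≤ |a.2 - p₀| := by
    intro a ha
    have := abs_lowPart_real_sub_le (lam := lam) (p := p₀) (p' := a.2)
      (measurableSet_Iio (a := a.1))
    rwa [show (lowPart lam a.2).real univ = a.2 from ha,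
      show (lowPart lam p₀).real univ = p₀ from h₀] at this
  refine tendsto_of_tendsto_of_tendsto_of_le_of_le' (hc'.mono_left nhdsWithin_le_nhds)
    (hc.mono_left nhdsWithin_le_nhds) ?_ ?_
  · filter_upwards [self_mem_nhdsWithin] with a ha
    linarith [(abs_le.1 (key a ha)).1]
  · filter_upwards [self_mem_nhdsWithin] with a ha
    linarith [(abs_le.1 (key a ha)).2]

theorem continuousOn_highPart (hac : lam ≪ volume) :
    ContinuousOn (fun a : ℝ × ℝ => (highPart lam a.2).real (Iio a.1))
      {a | (lowPart lam a.2).real univ = a.2} := by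
  refine (((continuous_map_fst_Iio hac).comp continuous_fst).continuousOn.sub
    (continuousOn_lowPart hac)).congr fun a _ => ?_
  exact eq_sub_of_add_eq' (lowPart_real_add_highPart_real a.2 measurableSet_Iio)

theorem measurable_lowPart_Iio :
    Measurable fun a : ℝ × ℝ => (lowPart lam a.2).real (Iio a.1) := by
  have hs : MeasurableSet {z : (ℝ × ℝ) × (ℝ × ℝ) | z.2.1 < z.1.1 ∧ errCdf lam z.2.2 < z.1.2} := by
    refine MeasurableSet.inter (s₁ := {z : (ℝ × ℝ) × (ℝ × ℝ) | z.2.1 < z.1.1})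
      (s₂ := {z | errCdf lam z.2.2 < z.1.2}) (measurableSet_lt (by fun_prop) (by fun_prop))
      (measurableSet_lt (measurable_errCdf.comp (by fun_prop)) (by fun_prop))
  have h := (measurable_measure_prodMk_left (ν := lam) hs).ennreal_toReal
  convert h using 2 with a
  rw [lowPart_real_apply measurableSet_Iio]
  rfl

theorem measurable_highPart_Iio :
    Measurable fun a : ℝ × ℝ => (highPart lam a.2).real (Iio a.1) := by
  have h : Monotone fun t => (lam.map Prod.fst).real (Iio t) := fun _ _ h =>
    measureReal_mono (Iio_subset_Iio h)
  have h' := (h.measurable.comp measurable_fst).sub (measurable_lowPart_Iio (lam := lam))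
  convert h' using 2 with a
  exact eq_sub_of_add_eq' (lowPart_real_add_highPart_real a.2 measurableSet_Iio)

end ErrorLaw

/-! ### The model in terms of the law of (X, Z) and the law of the errors -/

theorem measurable_indicator_of_continuousOn {E : Type*} [TopologicalSpace E] [MeasurableSpace E]
    [OpensMeasurableSpace E] {K : Set E} (hK : IsClosed K) {f : E → ℝ} (hf : ContinuousOn f K) :
    Measurable (K.indicator f) := by
  classical
  rw [← piecewise_eq_indicator]
  exact hf.measurable_piecewise continuousOn_const hK.measurableSet

namespace SVModel

variable {k l : ℕ} (M : SVModel.{u} k l)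

/-- The observed covariates and instruments. -/
def XZ (ω : M.Ω) : Vec k × Vec l := (M.X ω, M.Z ω)

/-- The error terms. -/
def err (ω : M.Ω) : ℝ × ℝ := (M.ε₁ ω, M.ε₂ ω)

/-- The law of the covariates and instruments. -/
noncomputable def lawXZ : Measure (Vec k × Vec l) := M.μ.map M.XZ

theorem measurable_XZ : Measurable M.XZ := M.measurable_X.prodMk M.measurable_Z

theorem measurable_err : Measurable M.err := M.measurable_ε₁.prodMk M.measurable_ε₂

instance : IsProbabilityMeasure M.errLaw := Measure.isProbabilityMeasure_map
  (M.measurable_err.aemeasurable)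

instance : IsProbabilityMeasure M.lawXZ := Measure.isProbabilityMeasure_map
  (M.measurable_XZ.aemeasurable)

theorem isClosed_suppXZ : IsClosed M.suppXZ := Measure.isClosed_support

theorem isClosed_suppX : IsClosed M.suppX := Measure.isClosed_support

theorem ae_mem_suppXZ : ∀ᵐ ω ∂M.μ, M.XZ ω ∈ M.suppXZ :=
  ae_of_ae_map M.measurable_XZ.aemeasurable Measure.support_mem_ae

theorem ae_mem_suppX : ∀ᵐ ω ∂M.μ, M.X ω ∈ M.suppX :=
  ae_of_ae_map M.measurable_X.aemeasurable Measure.support_mem_ae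

/-- The selection index, extended by zero from the support to a measurable function. -/
noncomputable def index₂ : Vec k × Vec l → ℝ := M.suppXZ.indicator fun q => M.ν₂ q.1 q.2

/-- The outcome index, extended by zero from the support to a measurable function. -/
noncomputable def index₁ (d : Fin 2) : Vec k → ℝ := M.suppX.indicator (M.ν₁ d)

/-- The propensity score as a function of covariates and instruments. -/
noncomputable def score (w : Vec k × Vec l) : ℝ := errCdf M.errLaw (M.index₂ w)

theorem index₁_of_mem (d : Fin 2) {x : Vec k} (hx : x ∈ M.suppX) : M.index₁ d x = M.ν₁ d x :=
  indicator_of_mem hx _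

theorem index₂_of_mem {w : Vec k × Vec l} (hw : w ∈ M.suppXZ) : M.index₂ w = M.ν₂ w.1 w.2 :=
  indicator_of_mem hw _

variable {M}

theorem ae_Ypot_eq_one_iff (d : Fin 2) : ∀ᵐ ω ∂M.μ,
    (M.Ypot d ω = 1 ↔ (M.err ω).1 < M.index₁ d (M.XZ ω).1) := by
  filter_upwards [M.ae_mem_suppX] with ω hω
  rw [show (M.XZ ω).1 = M.X ω from rfl, M.index₁_of_mem d hω]
  by_cases h : M.ν₁ d (M.X ω) > M.ε₁ ω <;> simp [SVModel.Ypot, err, h]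

theorem Y_eq_Ypot (ω : M.Ω) : M.Y ω = M.Ypot (M.D ω) ω := rfl

namespace Assumptions

theorem errLaw_ac (hM : M.Assumptions) : M.errLaw ≪ volume := by
  obtain ⟨f, -, -, h⟩ := hM.density
  rw [h]
  exact withDensity_absolutelyContinuous _ _

theorem ac_errLaw (hM : M.Assumptions) : volume ≪ M.errLaw := by
  obtain ⟨f, hf, hpos, h⟩ := hM.density
  rw [h]
  exact withDensity_absolutelyContinuous' hf.aemeasurable
    (Eventually.of_forall fun e => (hpos e).ne')

theorem measurable_index₂ (hM : M.Assumptions) : Measurable M.index₂ :=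
  measurable_indicator_of_continuousOn M.isClosed_suppXZ hM.continuous_ν₂

theorem measurable_score (hM : M.Assumptions) : Measurable M.score := measurable_errCdf.comp hM.measurable_index₂

theorem map_XZ_err (hM : M.Assumptions) : M.μ.map (fun ω => (M.XZ ω, M.err ω)) = M.lawXZ.prod M.errLaw :=
  (indepFun_iff_map_prod_eq_prod_map_map M.measurable_XZ.aemeasurable
    M.measurable_err.aemeasurable).1 hM.indep

/-- Independence makes the joint law a product, and Fubini integrates out the errors first. -/
theorem measure_XZ_err (hM : M.Assumptions) {A : Set ((Vec k × Vec l) × (ℝ × ℝ))} (hA : MeasurableSet A)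
    {S : Set (Vec k × Vec l)} (hS : MeasurableSet S) :
    M.μ {ω | (M.XZ ω, M.err ω) ∈ A ∧ M.XZ ω ∈ S}
      = ∫⁻ w in S, M.errLaw (Prod.mk w ⁻¹' A) ∂M.lawXZ := by
  have hm : Measurable fun ω => (M.XZ ω, M.err ω) := M.measurable_XZ.prodMk M.measurable_err
  have hAS : MeasurableSet (A ∩ Prod.fst ⁻¹' S) := hA.inter (measurable_fst hS)
  have h1 : M.μ {ω | (M.XZ ω, M.err ω) ∈ A ∧ M.XZ ω ∈ S}
      = (M.μ.map fun ω => (M.XZ ω, M.err ω)) (A ∩ Prod.fst ⁻¹' S) := by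
    rw [Measure.map_apply hm hAS]
    rfl
  rw [h1, hM.map_XZ_err, Measure.prod_apply hAS, ← lintegral_indicator hS]
  refine lintegral_congr fun w => ?_
  by_cases hw : w ∈ S
  · rw [indicator_of_mem hw]
    congr 1
    ext e
    simp [hw]
  · rw [indicator_of_notMem hw]
    convert measure_empty (μ := M.errLaw)
    ext e
    simp [hw]

theorem ae_D_eq_one_iff (hM : M.Assumptions) : ∀ᵐ ω ∂M.μ,
    (M.D ω = 1 ↔ errCdf M.errLaw (M.err ω).2 < M.score (M.XZ ω)) := by
  filter_upwards [M.ae_mem_suppXZ] with ω hω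
  rw [score, (strictMono_errCdf hM.ac_errLaw).lt_iff_lt, M.index₂_of_mem hω]
  by_cases h : M.ν₂ (M.X ω) (M.Z ω) > M.ε₂ ω <;> simp [SVModel.D, XZ, err, h]

theorem score_pos (hM : M.Assumptions) (w : Vec k × Vec l) : 0 < M.score w := errCdf_pos hM.ac_errLaw _

theorem score_lt_one (hM : M.Assumptions) (w : Vec k × Vec l) : M.score w < 1 := errCdf_lt_one hM.ac_errLaw _

theorem lowPart_score_univ (hM : M.Assumptions) (w : Vec k × Vec l) :
    (lowPart M.errLaw (M.score w)).real univ = M.score w :=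
  lowPart_errCdf_univ hM.ac_errLaw _

theorem highPart_score_univ (hM : M.Assumptions) (w : Vec k × Vec l) :
    (highPart M.errLaw (M.score w)).real univ = 1 - M.score w := by
  have h := lowPart_real_add_highPart_real (lam := M.errLaw) (M.score w) MeasurableSet.univ
  have : IsProbabilityMeasure (M.errLaw.map Prod.fst) :=
    Measure.isProbabilityMeasure_map measurable_fst.aemeasurable
  rw [hM.lowPart_score_univ, probReal_univ (μ := M.errLaw.map Prod.fst)] at h
  linarith

theorem measurableSet_lt_score (hM : M.Assumptions) : MeasurableSet
    {a : (Vec k × Vec l) × (ℝ × ℝ) | errCdf M.errLaw a.2.2 < M.score a.1} :=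
  measurableSet_lt (measurable_errCdf.comp (by fun_prop)) (hM.measurable_score.comp measurable_fst)

theorem aemeasurable_D (hM : M.Assumptions) : AEMeasurable M.D M.μ := by
  classical
  refine ⟨fun ω => if errCdf M.errLaw (M.err ω).2 < M.score (M.XZ ω) then 1 else 0,
    Measurable.ite ((M.measurable_XZ.prodMk M.measurable_err) hM.measurableSet_lt_score)
      measurable_const measurable_const, ?_⟩
  filter_upwards [hM.ae_D_eq_one_iff] with ω hω
  by_cases h : errCdf M.errLaw (M.err ω).2 < M.score (M.XZ ω)
  · simp [h, hω.2 h]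
  · have := mt hω.1 h
    simp only [h, if_false]
    omega

/-- The score lies strictly between 0 and 1, so both treatments occur near every point of Ω_X.
Consequently the continuity assumption on ν₁ covers both of its branches on all of Ω_X. -/
theorem suppDX_eq (hM : M.Assumptions) : M.suppDX = {q | q.2 ∈ M.suppX} := by
  have hDX : AEMeasurable (fun ω => (M.D ω, M.X ω)) M.μ :=
    hM.aemeasurable_D.prodMk M.measurable_X.aemeasurable
  refine Subset.antisymm ?_ ?_
  · refine Measure.support_subset_of_isClosed (M.isClosed_suppX.preimage continuous_snd) ?_
    refine (mem_ae_map_iff hDX (M.isClosed_suppX.preimage continuous_snd).measurableSet).2 ?_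
    exact M.ae_mem_suppX
  · rintro ⟨d, x⟩ hx
    refine (Measure.mem_support_iff_forall _).2 fun U hU => ?_
    obtain ⟨V, hV, B, hB, hVB⟩ := mem_nhds_prod_iff.1 hU
    obtain ⟨O, hOB, hO, hxO⟩ := mem_nhds_iff.1 hB
    have hpos : 0 < M.lawXZ (Prod.fst ⁻¹' O) := by
      have := (Measure.mem_support_iff_forall x).1 hx O (hO.mem_nhds hxO)
      rw [Measure.map_apply M.measurable_X hO.measurableSet] at this
      rwa [lawXZ, Measure.map_apply M.measurable_XZ (measurable_fst hO.measurableSet)]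
    -- It suffices to find an event that forces the treatment value `d` and has positive error
    -- probability at every value of (X, Z).
    have key : ∀ A : Set ((Vec k × Vec l) × (ℝ × ℝ)), MeasurableSet A →
        (∀ w, M.errLaw (Prod.mk w ⁻¹' A) ≠ 0) →
        (∀ᵐ ω ∂M.μ, (M.XZ ω, M.err ω) ∈ A → M.D ω = d) →
        0 < (M.μ.map fun ω => (M.D ω, M.X ω)) U := by
      intro A hA hne hAD
      have h1 : 0 < M.μ {ω | (M.XZ ω, M.err ω) ∈ A ∧ M.XZ ω ∈ Prod.fst ⁻¹' O} := by
        rw [hM.measure_XZ_err hA (measurable_fst hO.measurableSet),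
          setLIntegral_pos_iff (measurable_measure_prodMk_left hA)]
        rwa [show Function.support (fun w => M.errLaw (Prod.mk w ⁻¹' A)) = univ from
          eq_univ_of_forall hne, univ_inter]
      have h2 : (M.μ.map fun ω => (M.D ω, M.X ω)) ({d} ×ˢ O)
          ≤ (M.μ.map fun ω => (M.D ω, M.X ω)) U :=
        measure_mono ((prod_mono (singleton_subset_iff.2 (mem_of_mem_nhds hV)) hOB).trans hVB)
      refine (h1.trans_le ?_).trans_le h2
      rw [Measure.map_apply_of_aemeasurable hDX ((measurableSet_singleton d).prod hO.measurableSet)]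
      refine measure_mono_ae ?_
      filter_upwards [hAD] with ω hω h'
      exact ⟨hω h'.1, h'.2⟩
    have hd : d = 1 ∨ d = 0 := by omega
    rcases hd with rfl | rfl
    · refine key _ hM.measurableSet_lt_score (fun w h0 => ?_) ?_
      · have h' := hM.lowPart_score_univ w
        rw [lowPart_real_apply MeasurableSet.univ] at h'
        simp only [mem_univ, true_and] at h'
        have : M.errLaw.real {e | errCdf M.errLaw e.2 < M.score w} = 0 := by
          rw [Measure.real, show M.errLaw {e | errCdf M.errLaw e.2 < M.score w} = 0 from h0,
            ENNReal.toReal_zero]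
        linarith [hM.score_pos w]
      · filter_upwards [hM.ae_D_eq_one_iff] with ω hω
        exact hω.2
    · refine key _ hM.measurableSet_lt_score.compl (fun w h0 => ?_) ?_
      · have h' := hM.highPart_score_univ w
        rw [highPart_real_apply MeasurableSet.univ] at h'
        simp only [mem_univ, true_and, ← not_lt] at h'
        have : M.errLaw.real {e | ¬ errCdf M.errLaw e.2 < M.score w} = 0 := by
          rw [Measure.real, show M.errLaw {e | ¬ errCdf M.errLaw e.2 < M.score w} = 0 from h0,
            ENNReal.toReal_zero]
        linarith [hM.score_lt_one w]
      · filter_upwards [hM.ae_D_eq_one_iff] with ω hω h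
        have := mt hω.1 h
        omega

theorem continuousOn_ν₁ (hM : M.Assumptions) (d : Fin 2) : ContinuousOn (M.ν₁ d) M.suppX := by
  have h := hM.continuous_ν₁
  rw [hM.suppDX_eq] at h
  exact h.comp (f := fun x => (d, x)) (by fun_prop) fun x hx => hx

theorem measurable_index₁ (hM : M.Assumptions) (d : Fin 2) : Measurable (M.index₁ d) :=
  measurable_indicator_of_continuousOn M.isClosed_suppX (hM.continuousOn_ν₁ d)

theorem isCompact_suppX (hM : M.Assumptions) : IsCompact M.suppX := by
  have hK : IsCompact (Prod.fst '' M.suppXZ) := hM.compact.image continuous_fst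
  refine hK.of_isClosed_subset M.isClosed_suppX
    (Measure.support_subset_of_isClosed hK.isClosed ?_)
  rw [mem_ae_map_iff M.measurable_X.aemeasurable hK.isClosed.measurableSet]
  filter_upwards [M.ae_mem_suppXZ] with ω hω
  exact mem_image_of_mem Prod.fst hω

theorem measurableSet_lt_index₁ (hM : M.Assumptions) (d : Fin 2) : MeasurableSet
    {a : (Vec k × Vec l) × (ℝ × ℝ) | a.2.1 < M.index₁ d a.1.1} :=
  measurableSet_lt (by fun_prop) ((hM.measurable_index₁ d).comp (by fun_prop))

theorem aemeasurable_Ypot (hM : M.Assumptions) (d : Fin 2) : AEMeasurable (M.Ypot d) M.μ := by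
  classical
  refine ⟨fun ω => if (M.err ω).1 < M.index₁ d (M.XZ ω).1 then 1 else 0,
    Measurable.ite ((M.measurable_XZ.prodMk M.measurable_err) (hM.measurableSet_lt_index₁ d))
      measurable_const measurable_const, ?_⟩
  filter_upwards [ae_Ypot_eq_one_iff d] with ω hω
  by_cases h : (M.err ω).1 < M.index₁ d (M.XZ ω).1
  · simp [h, hω.2 h]
  · have := mt hω.1 h
    simp only [h, if_false]
    omega

theorem aemeasurable_Y (hM : M.Assumptions) : AEMeasurable M.Y M.μ := by
  classical
  have h : M.Y = fun ω => if M.D ω = 1 then M.Ypot 1 ω else M.Ypot 0 ω := by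
    funext ω
    by_cases h : M.D ω = 1
    · simp [h, Y_eq_Ypot]
    · have h0 : M.D ω = 0 := by omega
      simp [h0, Y_eq_Ypot]
  have hm : Measurable fun a : Fin 2 × Fin 2 × Fin 2 => if a.1 = 1 then a.2.1 else a.2.2 :=
    measurable_of_countable _
  rw [h]
  exact hm.comp_aemeasurable
    (hM.aemeasurable_D.prodMk ((hM.aemeasurable_Ypot 1).prodMk (hM.aemeasurable_Ypot 0)))

theorem aemeasurable_obs (hM : M.Assumptions) :
    AEMeasurable (fun ω => ((M.Y ω, M.D ω, M.X ω, M.Z ω) : Obs k l)) M.μ :=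
  hM.aemeasurable_Y.prodMk (hM.aemeasurable_D.prodMk M.measurable_XZ.aemeasurable)

/-- Probabilities of observed events as integrals of error probabilities. -/
theorem obsLaw_real_inter (hM : M.Assumptions) {C : Set (Fin 2 × Fin 2)} {A : Set ((Vec k × Vec l) × (ℝ × ℝ))}
    (hA : MeasurableSet A)
    (hCA : ∀ᵐ ω ∂M.μ, ((M.Y ω, M.D ω) ∈ C ↔ (M.XZ ω, M.err ω) ∈ A))
    {S : Set (Vec k × Vec l)} (hS : MeasurableSet S) :
    M.obsLaw.real {o | (o.Y, o.D) ∈ C ∧ (o.X, o.Z) ∈ S}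
      = ∫ w in S, M.errLaw.real (Prod.mk w ⁻¹' A) ∂M.lawXZ := by
  have hm : MeasurableSet {o : Obs k l | (o.Y, o.D) ∈ C ∧ (o.X, o.Z) ∈ S} := by
    have h1 : Measurable fun o : Obs k l => (o.Y, o.D) := by
      unfold Obs.Y Obs.D; fun_prop
    have h2 : Measurable fun o : Obs k l => (o.X, o.Z) := by
      unfold Obs.X Obs.Z; fun_prop
    exact (h1 C.toFinite.measurableSet).inter (h2 hS)
  have h1 : M.obsLaw.real {o | (o.Y, o.D) ∈ C ∧ (o.X, o.Z) ∈ S}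
      = M.μ.real {ω | (M.XZ ω, M.err ω) ∈ A ∧ M.XZ ω ∈ S} := by
    rw [Measure.real, obsLaw, Measure.map_apply_of_aemeasurable hM.aemeasurable_obs hm,
      Measure.real]
    congr 1
    refine measure_congr ?_
    filter_upwards [hCA] with ω hω
    exact propext (and_congr_left' hω)
  rw [h1, Measure.real, hM.measure_XZ_err hA hS]
  exact (integral_toReal (measurable_measure_prodMk_left hA).aemeasurable
    (Eventually.of_forall fun w => measure_lt_top _ _)).symm

end Assumptions

end SVModel

/-! ### The law of the observed data and the support of the propensity score -/

namespace Obs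

variable {k l : ℕ}

theorem measurable_YD : Measurable fun o : Obs k l => (o.Y, o.D) := by
  unfold Y D; fun_prop

theorem measurable_X : Measurable (X : Obs k l → Vec k) := by
  unfold X; fun_prop

theorem measurable_XZ : Measurable fun o : Obs k l => (o.X, o.Z) := by
  unfold X Z; fun_prop

theorem measurable_P (π : Measure (Obs k l)) : Measurable (P π) :=
  (stronglyMeasurable_condExp.mono measurable_XZ.comap_le).measurable

theorem measurable_XP (π : Measure (Obs k l)) : Measurable (XP π) :=
  measurable_X.prodMk (measurable_P π)

end Obs

namespace SVModel

variable {k l : ℕ} {M : SVModel.{u} k l}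

namespace Assumptions

theorem isProbabilityMeasure_obsLaw (hM : M.Assumptions) : IsProbabilityMeasure M.obsLaw :=
  Measure.isProbabilityMeasure_map hM.aemeasurable_obs

theorem map_obsLaw_XZ (hM : M.Assumptions) : M.obsLaw.map (fun o => (o.X, o.Z)) = M.lawXZ := by
  rw [obsLaw, AEMeasurable.map_map_of_aemeasurable Obs.measurable_XZ.aemeasurable
    hM.aemeasurable_obs]
  rfl

theorem obsLaw_suppX (hM : M.Assumptions) : Obs.suppX M.obsLaw = M.suppX := by
  rw [Obs.suppX, obsLaw, AEMeasurable.map_map_of_aemeasurable Obs.measurable_X.aemeasurable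
    hM.aemeasurable_obs]
  rfl

/-- On D = 1 the outcome is Y₁ and the rank of ε₂ is below the score, so the integrand is the error
probability at a fixed value of (X, Z). -/
theorem obsLaw_real_Y1_D1 (hM : M.Assumptions) {S : Set (Vec k × Vec l)} (hS : MeasurableSet S) :
    M.obsLaw.real {o | (o.Y, o.D) ∈ ({(1, 1)} : Set (Fin 2 × Fin 2)) ∧ (o.X, o.Z) ∈ S}
      = ∫ w in S, (lowPart M.errLaw (M.score w)).real (Iio (M.index₁ 1 w.1)) ∂M.lawXZ := by
  rw [hM.obsLaw_real_inter (C := {(1, 1)}) ((hM.measurableSet_lt_index₁ 1).inter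
    hM.measurableSet_lt_score) ?_ hS]
  · simp only [lowPart_real_apply measurableSet_Iio]
    rfl
  · filter_upwards [ae_Ypot_eq_one_iff (M := M) 1, hM.ae_D_eq_one_iff] with ω h1 h2
    rw [mem_singleton_iff, Prod.mk.injEq, mem_inter_iff, mem_ofPred_eq, mem_ofPred_eq, ← h1, ← h2]
    refine and_congr_left fun h => ?_
    rw [Y_eq_Ypot, h]

theorem obsLaw_real_Y1_D0 (hM : M.Assumptions) {S : Set (Vec k × Vec l)} (hS : MeasurableSet S) :
    M.obsLaw.real {o | (o.Y, o.D) ∈ ({(1, 0)} : Set (Fin 2 × Fin 2)) ∧ (o.X, o.Z) ∈ S}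
      = ∫ w in S, (highPart M.errLaw (M.score w)).real (Iio (M.index₁ 0 w.1)) ∂M.lawXZ := by
  rw [hM.obsLaw_real_inter (C := {(1, 0)}) ((hM.measurableSet_lt_index₁ 0).inter
    hM.measurableSet_lt_score.compl) ?_ hS]
  · simp only [highPart_real_apply measurableSet_Iio, ← not_lt]
    rfl
  · filter_upwards [ae_Ypot_eq_one_iff (M := M) 0, hM.ae_D_eq_one_iff] with ω h1 h2
    have h3 : M.D ω = 0 ↔ ¬ M.D ω = 1 := by omega
    rw [mem_singleton_iff, Prod.mk.injEq, mem_inter_iff, mem_compl_iff, mem_ofPred_eq,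
      mem_ofPred_eq, ← h1, ← h2, ← h3]
    refine and_congr_left fun h => ?_
    rw [Y_eq_Ypot, h]

theorem obsLaw_real_D1 (hM : M.Assumptions) {S : Set (Vec k × Vec l)} (hS : MeasurableSet S) :
    M.obsLaw.real {o | (o.Y, o.D) ∈ {c : Fin 2 × Fin 2 | c.2 = 1} ∧ (o.X, o.Z) ∈ S}
      = ∫ w in S, M.score w ∂M.lawXZ := by
  rw [hM.obsLaw_real_inter (C := {c | c.2 = 1}) hM.measurableSet_lt_score ?_ hS]
  · refine integral_congr_ae (Eventually.of_forall fun w => ?_)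
    have h := hM.lowPart_score_univ w
    rw [lowPart_real_apply MeasurableSet.univ] at h
    simpa only [mem_univ, true_and] using! h
  · filter_upwards [hM.ae_D_eq_one_iff] with ω h2
    exact h2

theorem obsLaw_real_D0 (hM : M.Assumptions) {S : Set (Vec k × Vec l)} (hS : MeasurableSet S) :
    M.obsLaw.real {o | (o.Y, o.D) ∈ {c : Fin 2 × Fin 2 | c.2 = 0} ∧ (o.X, o.Z) ∈ S}
      = ∫ w in S, (1 - M.score w) ∂M.lawXZ := by
  rw [hM.obsLaw_real_inter (C := {c | c.2 = 0}) hM.measurableSet_lt_score.compl ?_ hS]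
  · refine integral_congr_ae (Eventually.of_forall fun w => ?_)
    have h := hM.highPart_score_univ w
    rw [highPart_real_apply MeasurableSet.univ] at h
    simp only [mem_univ, true_and, ← not_lt] at h
    exact h
  · filter_upwards [hM.ae_D_eq_one_iff] with ω h2
    have h3 : M.D ω = 0 ↔ ¬ M.D ω = 1 := by omega
    exact h3.trans (not_congr h2)

theorem integrable_score (hM : M.Assumptions) : Integrable M.score M.lawXZ :=
  Integrable.of_bound hM.measurable_score.aestronglyMeasurable 1 (Eventually.of_forall fun w => by
    rw [Real.norm_of_nonneg (hM.score_pos w).le]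
    exact (hM.score_lt_one w).le)

/-- The propensity score of the observed data is the one implied by the model. -/
theorem P_ae_eq_score (hM : M.Assumptions) :
    Obs.P M.obsLaw =ᵐ[M.obsLaw] fun o => M.score (o.X, o.Z) := by
  have := hM.isProbabilityMeasure_obsLaw
  have hmD : MeasurableSet {o : Obs k l | o.D = 1} :=
    Obs.measurable_YD (toFinite {c : Fin 2 × Fin 2 | c.2 = 1}).measurableSet
  have hint : Integrable (fun o : Obs k l => M.score (o.X, o.Z)) M.obsLaw :=
    (hM.map_obsLaw_XZ ▸ hM.integrable_score).comp_measurable Obs.measurable_XZ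
  refine (ae_eq_condExp_of_forall_setIntegral_eq Obs.measurable_XZ.comap_le
    ((integrable_const _).indicator hmD) (fun _ _ _ => hint.integrableOn) ?_ ?_).symm
  · rintro _ ⟨S, hS, rfl⟩ -
    rw [setIntegral_indicator hmD, setIntegral_const, smul_eq_mul, mul_one,
      ← setIntegral_map hS (by
        rw [hM.map_obsLaw_XZ]; exact hM.measurable_score.aestronglyMeasurable)
      Obs.measurable_XZ.aemeasurable, hM.map_obsLaw_XZ, ← hM.obsLaw_real_D1 hS]
    congr 1
    ext o
    exact and_comm
  · exact ((hM.measurable_score.comp (comap_measurable _)).stronglyMeasurable).aestronglyMeasurable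

theorem lawP_eq (hM : M.Assumptions) : Obs.lawP M.obsLaw = M.lawXZ.map M.score := by
  rw [Obs.lawP, Measure.map_congr hM.P_ae_eq_score, ← hM.map_obsLaw_XZ,
    Measure.map_map hM.measurable_score Obs.measurable_XZ]
  rfl

theorem isProbabilityMeasure_lawP (hM : M.Assumptions) :
    IsProbabilityMeasure (Obs.lawP M.obsLaw) := by
  have := hM.isProbabilityMeasure_obsLaw
  exact Measure.isProbabilityMeasure_map (Obs.measurable_P _).aemeasurable

/-- The score is continuous on the compact Ω_{X,Z}, so its image is closed and carries the law of P.
Every point of Ω_P is thus an actual value of the distribution function of ε₂: it lies strictly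
inside (0, 1), and the rank falls below it with exactly that probability. -/
theorem suppP_subset (hM : M.Assumptions) : Obs.suppP M.obsLaw ⊆ M.score '' M.suppXZ := by
  have hc : ContinuousOn M.score M.suppXZ :=
    ((continuous_errCdf hM.errLaw_ac).comp_continuousOn hM.continuous_ν₂).congr fun w hw => by
      rw [score, M.index₂_of_mem hw]
      rfl
  have hK : IsClosed (M.score '' M.suppXZ) := (hM.compact.image_of_continuousOn hc).isClosed
  refine Measure.support_subset_of_isClosed hK ?_
  rw [hM.lawP_eq, mem_ae_map_iff hM.measurable_score.aemeasurable hK.measurableSet]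
  filter_upwards [show M.suppXZ ∈ ae M.lawXZ from Measure.support_mem_ae] with w hw
  exact mem_image_of_mem _ hw

theorem exists_errCdf_eq (hM : M.Assumptions) {p : ℝ} (hp : p ∈ Obs.suppP M.obsLaw) :
    ∃ q, errCdf M.errLaw q = p := by
  obtain ⟨w, -, hw⟩ := hM.suppP_subset hp
  exact ⟨_, hw⟩

theorem pos_of_mem_suppP (hM : M.Assumptions) {p : ℝ} (hp : p ∈ Obs.suppP M.obsLaw) : 0 < p := by
  obtain ⟨q, rfl⟩ := hM.exists_errCdf_eq hp
  exact errCdf_pos hM.ac_errLaw q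

theorem lt_one_of_mem_suppP (hM : M.Assumptions) {p : ℝ} (hp : p ∈ Obs.suppP M.obsLaw) :
    p < 1 := by
  obtain ⟨q, rfl⟩ := hM.exists_errCdf_eq hp
  exact errCdf_lt_one hM.ac_errLaw q

theorem lowPart_univ_of_mem_suppP (hM : M.Assumptions) {p : ℝ} (hp : p ∈ Obs.suppP M.obsLaw) :
    (lowPart M.errLaw p).real univ = p := by
  obtain ⟨q, rfl⟩ := hM.exists_errCdf_eq hp
  exact lowPart_errCdf_univ hM.ac_errLaw q

theorem highPart_univ_of_mem_suppP (hM : M.Assumptions) {p : ℝ} (hp : p ∈ Obs.suppP M.obsLaw) :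
    (highPart M.errLaw p).real univ = 1 - p := by
  obtain ⟨w, -, rfl⟩ := hM.suppP_subset hp
  exact hM.highPart_score_univ w

theorem isCompact_suppP (hM : M.Assumptions) : IsCompact (Obs.suppP M.obsLaw) := by
  refine isCompact_Icc.of_isClosed_subset (s := Icc (0 : ℝ) 1) Measure.isClosed_support ?_
  exact fun p hp => ⟨(hM.pos_of_mem_suppP hp).le, (hM.lt_one_of_mem_suppP hp).le⟩

theorem nonempty_suppP (hM : M.Assumptions) : (Obs.suppP M.obsLaw).Nonempty := by
  have := hM.isProbabilityMeasure_lawP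
  exact Measure.nonempty_support (IsProbabilityMeasure.ne_zero _)

theorem isLeast_pLow (hM : M.Assumptions) : IsLeast (Obs.suppP M.obsLaw) (Obs.pLow M.obsLaw) :=
  hM.isCompact_suppP.isLeast_sInf hM.nonempty_suppP

theorem isGreatest_pHigh (hM : M.Assumptions) :
    IsGreatest (Obs.suppP M.obsLaw) (Obs.pHigh M.obsLaw) :=
  hM.isCompact_suppP.isGreatest_sSup hM.nonempty_suppP

/-- This is where non-degeneracy enters. A one-point Ω_P makes the score constant almost surely,
hence also ν₂(X, Z) by injectivity of the distribution function, and its conditional law would be a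
Dirac mass. -/
theorem pLow_lt_pHigh (hM : M.Assumptions) : Obs.pLow M.obsLaw < Obs.pHigh M.obsLaw := by
  by_contra! hle
  have h1 : ∀ᵐ w ∂M.lawXZ, M.score w = Obs.pLow M.obsLaw := by
    have h : ∀ᵐ p ∂(M.lawXZ.map M.score), p ∈ Obs.suppP M.obsLaw := by
      rw [← hM.lawP_eq]; exact Measure.support_mem_ae
    filter_upwards [ae_of_ae_map hM.measurable_score.aemeasurable h] with w hw
    exact le_antisymm ((hM.isGreatest_pHigh.2 hw).trans hle) (hM.isLeast_pLow.2 hw)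
  obtain ⟨c, hc⟩ := hM.exists_errCdf_eq hM.isLeast_pLow.1
  have h2 : (fun ω => M.ν₂ (M.X ω) (M.Z ω)) =ᵐ[M.μ] fun _ => c := by
    filter_upwards [ae_of_ae_map M.measurable_XZ.aemeasurable h1, M.ae_mem_suppXZ] with ω hω hs
    rw [← hc, score, M.index₂_of_mem hs] at hω
    exact (strictMono_errCdf hM.ac_errLaw).injective hω
  have h3 := hM.nondegenerate
  rw [condDistrib_congr_left h2] at h3
  have hp : IsProbabilityMeasure (M.μ.map M.X) :=
    Measure.isProbabilityMeasure_map M.measurable_X.aemeasurable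
  obtain ⟨x, hx, hx'⟩ := (h3.and (condDistrib_const (μ := M.μ) M.X c)).exists
  exact hx c (by rw [hx', Kernel.deterministic_apply])

/-! ### Pointwise conditional probabilities and the ATE in terms of the error law -/

theorem XP_ae_eq (hM : M.Assumptions) :
    ∀ᵐ o ∂M.obsLaw, Obs.XP M.obsLaw o = (o.X, M.score (o.X, o.Z)) := by
  filter_upwards [hM.P_ae_eq_score] with o ho
  rw [Obs.XP, ho]

/-- Convergence of the elementary conditional probabilities of observed events. -/
theorem tendsto_obsLaw_ball (hM : M.Assumptions) {C : Set (Fin 2 × Fin 2)} {g : Vec k × ℝ → ℝ}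
    (hgm : Measurable g) (hg0 : ∀ w : Vec k × Vec l, 0 ≤ g (w.1, M.score w))
    (hg1 : ∀ w : Vec k × Vec l, g (w.1, M.score w) ≤ 1)
    (hC : ∀ S : Set (Vec k × Vec l), MeasurableSet S →
      M.obsLaw.real {o | (o.Y, o.D) ∈ C ∧ (o.X, o.Z) ∈ S}
        = ∫ w in S, g (w.1, M.score w) ∂M.lawXZ)
    {a : Vec k × ℝ} (ha : a ∈ Obs.suppXP M.obsLaw)
    (hg : ContinuousWithinAt g (Obs.suppXP M.obsLaw) a) :
    Tendsto (fun r => (∫ o in Obs.XP M.obsLaw ⁻¹' Metric.ball a r,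
        {o : Obs k l | (o.Y, o.D) ∈ C}.indicator (fun _ => (1 : ℝ)) o ∂M.obsLaw)
          / M.obsLaw.real (Obs.XP M.obsLaw ⁻¹' Metric.ball a r)) (𝓝[>] 0) (𝓝 (g a)) := by
  have := hM.isProbabilityMeasure_obsLaw
  have hgs : Measurable fun w : Vec k × Vec l => g (w.1, M.score w) :=
    hgm.comp (measurable_fst.prodMk hM.measurable_score)
  refine tendsto_setIntegral_ball_div (Obs.measurable_XP _) ha hg ?_ fun r => ?_
  · refine Integrable.of_bound (hgm.comp (Obs.measurable_XP _)).aestronglyMeasurable 1 ?_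
    filter_upwards [hM.XP_ae_eq] with o ho
    rw [ho, Real.norm_of_nonneg (hg0 (o.X, o.Z))]
    exact hg1 (o.X, o.Z)
  · set S : Set (Vec k × Vec l) := {w | (w.1, M.score w) ∈ Metric.ball a r} with hSdef
    have hS : MeasurableSet S :=
      (measurable_fst.prodMk hM.measurable_score) Metric.isOpen_ball.measurableSet
    -- The conditional expectation P agrees with the score only almost surely, so the ball event is
    -- replaced by an event about (X, Z) up to a null set.
    have hpre : (Obs.XP M.obsLaw ⁻¹' Metric.ball a r : Set (Obs k l))
        =ᵐ[M.obsLaw] (fun o : Obs k l => (o.X, o.Z)) ⁻¹' S := by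
      filter_upwards [hM.XP_ae_eq] with o ho
      refine propext ?_
      change Obs.XP M.obsLaw o ∈ Metric.ball a r ↔ _
      rw [ho]
      rfl
    have hmC : MeasurableSet {o : Obs k l | (o.Y, o.D) ∈ C} :=
      Obs.measurable_YD C.toFinite.measurableSet
    rw [setIntegral_congr_set hpre, setIntegral_congr_set hpre, setIntegral_indicator hmC,
      setIntegral_const, smul_eq_mul, mul_one]
    have h1 : ∫ o in (fun o : Obs k l => (o.X, o.Z)) ⁻¹' S, g (Obs.XP M.obsLaw o) ∂M.obsLaw
        = ∫ o in (fun o : Obs k l => (o.X, o.Z)) ⁻¹' S,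
          (fun w : Vec k × Vec l => g (w.1, M.score w)) (o.X, o.Z) ∂M.obsLaw := by
      refine integral_congr_ae (ae_restrict_of_ae ?_)
      filter_upwards [hM.XP_ae_eq] with o ho
      rw [ho]
    rw [h1, ← setIntegral_map hS hgs.aestronglyMeasurable Obs.measurable_XZ.aemeasurable,
      hM.map_obsLaw_XZ, ← hC S hS]
    congr 1
    ext o
    exact and_comm

theorem continuousOn_index₁ (hM : M.Assumptions) (d : Fin 2) :
    ContinuousOn (M.index₁ d) M.suppX :=
  (hM.continuousOn_ν₁ d).congr fun _ hx => M.index₁_of_mem d hx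

theorem suppXP_eq (hM : M.Assumptions) (hprod : Obs.ProductSupport M.obsLaw) :
    Obs.suppXP M.obsLaw = M.suppX ×ˢ Obs.suppP M.obsLaw := by
  rw [hprod, hM.obsLaw_suppX]

theorem suppPGiven_eq (hM : M.Assumptions) (hprod : Obs.ProductSupport M.obsLaw) {x : Vec k}
    (hx : x ∈ M.suppX) : Obs.suppPGiven M.obsLaw x = Obs.suppP M.obsLaw := by
  ext p
  rw [Obs.suppPGiven, mem_ofPred_eq, hM.suppXP_eq hprod]
  exact and_iff_right hx

theorem tendsto_Y1_D1 (hM : M.Assumptions) (hprod : Obs.ProductSupport M.obsLaw) {x : Vec k}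
    (hx : x ∈ M.suppX) {p : ℝ} (hp : p ∈ Obs.suppP M.obsLaw) :
    Tendsto (fun r => (∫ o in Obs.XP M.obsLaw ⁻¹' Metric.ball (x, p) r,
        {o : Obs k l | (o.Y, o.D) ∈ ({(1, 1)} : Set (Fin 2 × Fin 2))}.indicator
          (fun _ => (1 : ℝ)) o ∂M.obsLaw)
          / M.obsLaw.real (Obs.XP M.obsLaw ⁻¹' Metric.ball (x, p) r)) (𝓝[>] 0)
      (𝓝 ((lowPart M.errLaw p).real (Iio (M.ν₁ 1 x)))) := by
  have hmem : (x, p) ∈ Obs.suppXP M.obsLaw := by rw [hM.suppXP_eq hprod]; exact ⟨hx, hp⟩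
  have hpair : Measurable fun a : Vec k × ℝ => (M.index₁ 1 a.1, a.2) :=
    ((hM.measurable_index₁ 1).comp measurable_fst).prodMk measurable_snd
  have h := hM.tendsto_obsLaw_ball (C := {(1, 1)})
    (g := fun a => (lowPart M.errLaw a.2).real (Iio (M.index₁ 1 a.1)))
    (measurable_lowPart_Iio.comp hpair)
    (fun _ => measureReal_nonneg)
    (fun w => by
      rw [lowPart_real_apply measurableSet_Iio]
      exact measureReal_le_one)
    (fun S hS => hM.obsLaw_real_Y1_D1 hS) hmem ?_
  · simpa only [M.index₁_of_mem 1 hx] using h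
  · refine ((continuousOn_lowPart hM.errLaw_ac).comp
      (f := fun a : Vec k × ℝ => (M.index₁ 1 a.1, a.2))
      (ContinuousOn.prodMk ((hM.continuousOn_index₁ 1).comp continuousOn_fst ?_)
        continuousOn_snd) ?_) _ hmem
    · intro a ha
      rw [hM.suppXP_eq hprod] at ha
      exact ha.1
    · intro a ha
      rw [hM.suppXP_eq hprod] at ha
      exact hM.lowPart_univ_of_mem_suppP ha.2

theorem tendsto_Y1_D0 (hM : M.Assumptions) (hprod : Obs.ProductSupport M.obsLaw) {x : Vec k}
    (hx : x ∈ M.suppX) {p : ℝ} (hp : p ∈ Obs.suppP M.obsLaw) :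
    Tendsto (fun r => (∫ o in Obs.XP M.obsLaw ⁻¹' Metric.ball (x, p) r,
        {o : Obs k l | (o.Y, o.D) ∈ ({(1, 0)} : Set (Fin 2 × Fin 2))}.indicator
          (fun _ => (1 : ℝ)) o ∂M.obsLaw)
          / M.obsLaw.real (Obs.XP M.obsLaw ⁻¹' Metric.ball (x, p) r)) (𝓝[>] 0)
      (𝓝 ((highPart M.errLaw p).real (Iio (M.ν₁ 0 x)))) := by
  have hmem : (x, p) ∈ Obs.suppXP M.obsLaw := by rw [hM.suppXP_eq hprod]; exact ⟨hx, hp⟩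
  have hpair : Measurable fun a : Vec k × ℝ => (M.index₁ 0 a.1, a.2) :=
    ((hM.measurable_index₁ 0).comp measurable_fst).prodMk measurable_snd
  have h := hM.tendsto_obsLaw_ball (C := {(1, 0)})
    (g := fun a => (highPart M.errLaw a.2).real (Iio (M.index₁ 0 a.1)))
    (measurable_highPart_Iio.comp hpair)
    (fun _ => measureReal_nonneg)
    (fun w => by
      rw [highPart_real_apply measurableSet_Iio]
      exact measureReal_le_one)
    (fun S hS => hM.obsLaw_real_Y1_D0 hS) hmem ?_
  · simpa only [M.index₁_of_mem 0 hx] using h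
  · refine ((continuousOn_highPart hM.errLaw_ac).comp
      (f := fun a : Vec k × ℝ => (M.index₁ 0 a.1, a.2))
      (ContinuousOn.prodMk ((hM.continuousOn_index₁ 0).comp continuousOn_fst ?_)
        continuousOn_snd) ?_) _ hmem
    · intro a ha
      rw [hM.suppXP_eq hprod] at ha
      exact ha.1
    · intro a ha
      rw [hM.suppXP_eq hprod] at ha
      exact hM.lowPart_univ_of_mem_suppP ha.2

theorem prYD_one_one (hM : M.Assumptions) (hprod : Obs.ProductSupport M.obsLaw) {x : Vec k}
    (hx : x ∈ M.suppX) {p : ℝ} (hp : p ∈ Obs.suppP M.obsLaw) :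
    Obs.prYD M.obsLaw 1 1 x p = (lowPart M.errLaw p).real (Iio (M.ν₁ 1 x)) := by
  rw [← condMeanAt_eq_of_tendsto (hM.tendsto_Y1_D1 hprod hx hp), Obs.prYD, condProbAt]
  simp only [mem_singleton_iff, Prod.mk.injEq]

theorem prYD_one_zero (hM : M.Assumptions) (hprod : Obs.ProductSupport M.obsLaw) {x : Vec k}
    (hx : x ∈ M.suppX) {p : ℝ} (hp : p ∈ Obs.suppP M.obsLaw) :
    Obs.prYD M.obsLaw 1 0 x p = (highPart M.errLaw p).real (Iio (M.ν₁ 0 x)) := by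
  rw [← condMeanAt_eq_of_tendsto (hM.tendsto_Y1_D0 hprod hx hp), Obs.prYD, condProbAt]
  simp only [mem_singleton_iff, Prod.mk.injEq]

/-- Bayes' rule in the limit: the probabilities of D = 1 over shrinking balls tend to `p`, which is
positive. -/
theorem prYGivenD_one_one (hM : M.Assumptions) (hprod : Obs.ProductSupport M.obsLaw) {x : Vec k}
    (hx : x ∈ M.suppX) {p : ℝ} (hp : p ∈ Obs.suppP M.obsLaw) :
    Obs.prYGivenD M.obsLaw 1 1 x p = (lowPart M.errLaw p).real (Iio (M.ν₁ 1 x)) / p := by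
  have := hM.isProbabilityMeasure_obsLaw
  have hmem : (x, p) ∈ Obs.suppXP M.obsLaw := by rw [hM.suppXP_eq hprod]; exact ⟨hx, hp⟩
  have h := hM.tendsto_Y1_D1 hprod hx hp
  simp only [mem_singleton_iff, Prod.mk.injEq] at h
  refine condProbAt_cond_eq_div (Obs.measurable_YD
      (toFinite {c : Fin 2 × Fin 2 | c.1 = 1}).measurableSet)
    (Obs.measurable_YD (toFinite {c : Fin 2 × Fin 2 | c.2 = 1}).measurableSet)
    (Obs.measurable_XP _) hmem (hM.pos_of_mem_suppP hp).ne' h ?_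
  exact hM.tendsto_obsLaw_ball (C := {c | c.2 = 1}) (g := fun a => a.2) measurable_snd
    (fun w => (hM.score_pos w).le) (fun w => (hM.score_lt_one w).le)
    (fun S hS => hM.obsLaw_real_D1 hS) hmem continuous_snd.continuousWithinAt

theorem prYGivenD_one_zero (hM : M.Assumptions) (hprod : Obs.ProductSupport M.obsLaw) {x : Vec k}
    (hx : x ∈ M.suppX) {p : ℝ} (hp : p ∈ Obs.suppP M.obsLaw) :
    Obs.prYGivenD M.obsLaw 1 0 x p = (highPart M.errLaw p).real (Iio (M.ν₁ 0 x)) / (1 - p) := by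
  have := hM.isProbabilityMeasure_obsLaw
  have hmem : (x, p) ∈ Obs.suppXP M.obsLaw := by rw [hM.suppXP_eq hprod]; exact ⟨hx, hp⟩
  have h := hM.tendsto_Y1_D0 hprod hx hp
  simp only [mem_singleton_iff, Prod.mk.injEq] at h
  refine condProbAt_cond_eq_div (Obs.measurable_YD
      (toFinite {c : Fin 2 × Fin 2 | c.1 = 1}).measurableSet)
    (Obs.measurable_YD (toFinite {c : Fin 2 × Fin 2 | c.2 = 0}).measurableSet)
    (Obs.measurable_XP _) hmem (sub_pos.2 (hM.lt_one_of_mem_suppP hp)).ne' h ?_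
  exact hM.tendsto_obsLaw_ball (C := {c | c.2 = 0}) (g := fun a => 1 - a.2) (by fun_prop)
    (fun w => sub_nonneg.2 (hM.score_lt_one w).le)
    (fun w => sub_le_self _ (hM.score_pos w).le)
    (fun S hS => hM.obsLaw_real_D0 hS) hmem
    (continuous_const.sub continuous_snd).continuousWithinAt

/-- The conditional mean of a potential outcome is the marginal distribution function of the first
error term at the index. -/
theorem condMeanAt_Ypot (hM : M.Assumptions) (d : Fin 2) {x : Vec k} (hx : x ∈ M.suppX) :
    condMeanAt M.μ (fun ω => ((M.Ypot d ω : ℕ) : ℝ)) M.X x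
      = (M.errLaw.map Prod.fst).real (Iio (M.ν₁ d x)) := by
  have hF := continuous_map_fst_Iio hM.errLaw_ac
  have : IsProbabilityMeasure (M.errLaw.map Prod.fst) :=
    Measure.isProbabilityMeasure_map measurable_fst.aemeasurable
  have hgm : Measurable fun x => (M.errLaw.map Prod.fst).real (Iio (M.index₁ d x)) :=
    hF.measurable.comp (hM.measurable_index₁ d)
  rw [← M.index₁_of_mem d hx]
  refine condMeanAt_eq_of_tendsto (tendsto_setIntegral_ball_div
    (g := fun x => (M.errLaw.map Prod.fst).real (Iio (M.index₁ d x))) M.measurable_X hx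
    (hF.comp_continuousOn (hM.continuousOn_index₁ d) x hx) ?_ fun r => ?_)
  · refine Integrable.of_bound (hgm.comp M.measurable_X).aestronglyMeasurable 1
      (Eventually.of_forall fun ω => ?_)
    rw [Real.norm_of_nonneg measureReal_nonneg]
    exact measureReal_le_one
  · have hS : MeasurableSet (Prod.fst ⁻¹' Metric.ball x r : Set (Vec k × Vec l)) :=
      measurable_fst Metric.isOpen_ball.measurableSet
    have hA := hM.measurableSet_lt_index₁ d
    have hA' : MeasurableSet {ω | (M.err ω).1 < M.index₁ d (M.XZ ω).1} :=
      (M.measurable_XZ.prodMk M.measurable_err) hA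
    have h1 : ∫ ω in M.X ⁻¹' Metric.ball x r, ((M.Ypot d ω : ℕ) : ℝ) ∂M.μ
        = ∫ ω in M.X ⁻¹' Metric.ball x r,
          {ω | (M.err ω).1 < M.index₁ d (M.XZ ω).1}.indicator (fun _ => (1 : ℝ)) ω ∂M.μ := by
      refine integral_congr_ae (ae_restrict_of_ae ?_)
      filter_upwards [ae_Ypot_eq_one_iff (M := M) d] with ω hω
      by_cases h : (M.err ω).1 < M.index₁ d (M.XZ ω).1
      · simp [h, hω.2 h]
      · have h0 : M.Ypot d ω = 0 := by
          have := mt hω.1 h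
          omega
        simp [h, h0]
    have h2 : ∫ ω in M.X ⁻¹' Metric.ball x r,
          (M.errLaw.map Prod.fst).real (Iio (M.index₁ d (M.X ω))) ∂M.μ
        = ∫ w in Prod.fst ⁻¹' Metric.ball x r,
          (M.errLaw.map Prod.fst).real (Iio (M.index₁ d w.1)) ∂M.lawXZ := by
      exact (setIntegral_map hS (hgm.comp measurable_fst).aestronglyMeasurable
        M.measurable_XZ.aemeasurable).symm
    rw [h1, h2, setIntegral_indicator hA', setIntegral_const, smul_eq_mul, mul_one]
    have h3 : M.X ⁻¹' Metric.ball x r ∩ {ω | (M.err ω).1 < M.index₁ d (M.XZ ω).1}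
        = {ω | (M.XZ ω, M.err ω) ∈ {a : (Vec k × Vec l) × (ℝ × ℝ) | a.2.1 < M.index₁ d a.1.1}
          ∧ M.XZ ω ∈ Prod.fst ⁻¹' Metric.ball x r} := by
      ext ω
      exact and_comm
    rw [h3, Measure.real, hM.measure_XZ_err hA hS,
      ← integral_toReal (measurable_measure_prodMk_left hA).aemeasurable
        (Eventually.of_forall fun w => measure_lt_top _ _)]
    refine integral_congr_ae (Eventually.of_forall fun w => ?_)
    simp only [map_measureReal_apply measurable_fst measurableSet_Iio]
    rfl

theorem ATE_eq (hM : M.Assumptions) {x : Vec k} (hx : x ∈ M.suppX) :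
    M.ATE x = (M.errLaw.map Prod.fst).real (Iio (M.ν₁ 1 x))
      - (M.errLaw.map Prod.fst).real (Iio (M.ν₁ 0 x)) := by
  rw [ATE, hM.condMeanAt_Ypot 1 hx, hM.condMeanAt_Ypot 0 hx]

end Assumptions

end SVModel

/-! ### Ranges of thresholds -/

/-- The union of the half-lines below those values of `f` on `K` that are at most `t`. -/
def innerRay {E : Type*} (K : Set E) (f : E → ℝ) (t : ℝ) : Set ℝ :=
  ⋃ x ∈ {x ∈ K | f x ≤ t}, Iio (f x)

/-- The intersection of the half-lines below those values of `f` on `K` that are at least `t`. -/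
def outerRay {E : Type*} (K : Set E) (f : E → ℝ) (t : ℝ) : Set ℝ :=
  ⋂ x ∈ {x ∈ K | t ≤ f x}, Iio (f x)

section Rays

variable {E : Type*} {K : Set E} {f : E → ℝ} {t : ℝ}

theorem innerRay_subset : innerRay K f t ⊆ Iio t :=
  iUnion₂_subset fun _ hx => Iio_subset_Iio hx.2

theorem subset_outerRay : Iio t ⊆ outerRay K f t :=
  subset_iInter₂ fun _ hx => Iio_subset_Iio hx.2

theorem measurableSet_innerRay : MeasurableSet (innerRay K f t) :=
  (isOpen_biUnion fun _ _ => isOpen_Iio).measurableSet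

theorem measurableSet_outerRay : MeasurableSet (outerRay K f t) :=
  (isLowerSet_iInter₂ fun _ _ => isLowerSet_Iio _).ordConnected.measurableSet

theorem innerRay_congr {g : E → ℝ} (h : ∀ x ∈ K, f x = g x) :
    innerRay K f t = innerRay K g t := by
  have hs : {x ∈ K | f x ≤ t} = {x ∈ K | g x ≤ t} := by
    ext x
    exact and_congr_right fun hx => by rw [h x hx]
  rw [innerRay, innerRay, hs]
  exact iUnion₂_congr fun x hx => by rw [h x hx.1]

theorem outerRay_congr {g : E → ℝ} (h : ∀ x ∈ K, f x = g x) :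
    outerRay K f t = outerRay K g t := by
  have hs : {x ∈ K | t ≤ f x} = {x ∈ K | t ≤ g x} := by
    ext x
    exact and_congr_right fun hx => by rw [h x hx]
  rw [outerRay, outerRay, hs]
  exact iInter₂_congr fun x hx => by rw [h x hx.1]

end Rays

namespace SVModel

variable {k l : ℕ} {M : SVModel.{u} k l}

namespace Assumptions

/-! ### The sign of `H` -/

/-- The event P > P' has positive probability: a point between the two extreme scores separates
neighbourhoods of them, and both are charged. Otherwise the conditional measure would be zero and H
would carry no information. -/
theorem isProbabilityMeasure_cond_lawP (hM : M.Assumptions) :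
    IsProbabilityMeasure
      (((Obs.lawP M.obsLaw).prod (Obs.lawP M.obsLaw))[|{q : ℝ × ℝ | q.1 > q.2}]) := by
  have := hM.isProbabilityMeasure_lawP
  obtain ⟨m, hm1, hm2⟩ := exists_between hM.pLow_lt_pHigh
  refine cond_isProbabilityMeasure (ne_of_gt ?_)
  have h1 := (Measure.mem_support_iff_forall _).1 hM.isGreatest_pHigh.1 _ (Ioi_mem_nhds hm2)
  have h2 := (Measure.mem_support_iff_forall _).1 hM.isLeast_pLow.1 _ (Iio_mem_nhds hm1)
  refine lt_of_lt_of_le ?_ (measure_mono (s := Ioi m ×ˢ Iio m) fun q hq => ?_)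
  · rw [Measure.prod_prod]
    exact ENNReal.mul_pos h1.ne' h2.ne'
  · exact lt_trans (b := m) hq.2 hq.1

theorem ae_cond_lawP (hM : M.Assumptions) :
    ∀ᵐ q ∂(((Obs.lawP M.obsLaw).prod (Obs.lawP M.obsLaw))[|{q : ℝ × ℝ | q.1 > q.2}]),
      q.1 ∈ Obs.suppP M.obsLaw ∧ q.2 ∈ Obs.suppP M.obsLaw ∧ q.2 < q.1 := by
  have := hM.isProbabilityMeasure_lawP
  have h0 : ∀ᵐ p ∂(Obs.lawP M.obsLaw), p ∈ Obs.suppP M.obsLaw := Measure.support_mem_ae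
  have h1 := (Measure.quasiMeasurePreserving_fst (μ := Obs.lawP M.obsLaw)
    (ν := Obs.lawP M.obsLaw)).ae h0
  have h2 := (Measure.quasiMeasurePreserving_snd (μ := Obs.lawP M.obsLaw)
    (ν := Obs.lawP M.obsLaw)).ae h0
  have hac := cond_absolutelyContinuous (μ := (Obs.lawP M.obsLaw).prod (Obs.lawP M.obsLaw))
    (s := {q : ℝ × ℝ | q.1 > q.2})
  filter_upwards [hac.ae_le h1, hac.ae_le h2,
    ae_cond_mem (measurableSet_lt measurable_snd measurable_fst)] with q hq1 hq2 hq3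
  exact ⟨hq1, hq2, hq3⟩

/-- The difference of the masses of two thresholds between two ranks of the second error term. -/
noncomputable def _root_.massDiff (lam : Measure (ℝ × ℝ)) (t t' : ℝ) (q : ℝ × ℝ) : ℝ :=
  ((lowPart lam q.1).real (Iio t') - (lowPart lam q.2).real (Iio t'))
    - ((lowPart lam q.1).real (Iio t) - (lowPart lam q.2).real (Iio t))

/-- Low and high parts add up to a law that does not depend on the rank cut, so differences of the
high part in `p` are minus those of the low part. -/
theorem H_eq (hM : M.Assumptions) (hprod : Obs.ProductSupport M.obsLaw) {x x' : Vec k}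
    (hx : x ∈ M.suppX) (hx' : x' ∈ M.suppX) :
    Obs.H M.obsLaw x x' = ∫ q, massDiff M.errLaw (M.ν₁ 0 x) (M.ν₁ 1 x') q
      ∂(((Obs.lawP M.obsLaw).prod (Obs.lawP M.obsLaw))[|{q : ℝ × ℝ | q.1 > q.2}]) := by
  refine integral_congr_ae ?_
  filter_upwards [hM.ae_cond_lawP] with q hq
  rw [Obs.h, hM.prYD_one_one hprod hx' hq.1, hM.prYD_one_one hprod hx' hq.2.1,
    hM.prYD_one_zero hprod hx hq.1, hM.prYD_one_zero hprod hx hq.2.1, massDiff]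
  have h1 := lowPart_real_add_highPart_real (lam := M.errLaw) q.1
    (measurableSet_Iio (a := M.ν₁ 0 x))
  have h2 := lowPart_real_add_highPart_real (lam := M.errLaw) q.2
    (measurableSet_Iio (a := M.ν₁ 0 x))
  linarith

theorem _root_.measurable_massDiff {lam : Measure (ℝ × ℝ)} [IsProbabilityMeasure lam] (t t' : ℝ) :
    Measurable (massDiff lam t t') := by
  have h : ∀ s, Measurable fun p => (lowPart lam p).real (Iio s) := fun s =>
    measurable_lowPart_Iio.comp (measurable_const.prodMk measurable_id)
  exact (((h t').comp measurable_fst).sub ((h t').comp measurable_snd)).sub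
    (((h t).comp measurable_fst).sub ((h t).comp measurable_snd))

theorem _root_.abs_massDiff_le {lam : Measure (ℝ × ℝ)} [IsProbabilityMeasure lam] (t t' : ℝ)
    (q : ℝ × ℝ) : |massDiff lam t t' q| ≤ 2 := by
  have h : ∀ s p, 0 ≤ (lowPart lam p).real (Iio s) ∧ (lowPart lam p).real (Iio s) ≤ 1 :=
    fun s p => ⟨measureReal_nonneg, by
      rw [lowPart_real_apply measurableSet_Iio]; exact measureReal_le_one⟩
  rw [abs_le, massDiff]
  constructor <;> linarith [h t q.1, h t q.2, h t' q.1, h t' q.2]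

theorem integral_massDiff_pos (hM : M.Assumptions) {t t' : ℝ} (h : t < t') :
    0 < ∫ q, massDiff M.errLaw t t' q
      ∂(((Obs.lawP M.obsLaw).prod (Obs.lawP M.obsLaw))[|{q : ℝ × ℝ | q.1 > q.2}]) := by
  have := hM.isProbabilityMeasure_cond_lawP
  have hpos : ∀ᵐ q ∂(((Obs.lawP M.obsLaw).prod (Obs.lawP M.obsLaw))[|{q : ℝ × ℝ | q.1 > q.2}]),
      0 < massDiff M.errLaw t t' q := by
    filter_upwards [hM.ae_cond_lawP] with q ⟨h1, h2, h3⟩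
    obtain ⟨a, ha⟩ := hM.exists_errCdf_eq h1
    obtain ⟨b, hb⟩ := hM.exists_errCdf_eq h2
    rw [← ha, ← hb, (strictMono_errCdf hM.ac_errLaw).lt_iff_lt] at h3
    rw [massDiff, ← ha, ← hb]
    exact sub_pos.2 (lowPart_real_sub_strictMono hM.ac_errLaw h3 h)
  have hnn : 0 ≤ᵐ[((Obs.lawP M.obsLaw).prod (Obs.lawP M.obsLaw))[|{q : ℝ × ℝ | q.1 > q.2}]]
      massDiff M.errLaw t t' := hpos.mono fun q hq => hq.le
  refine lt_of_le_of_ne (integral_nonneg_of_ae hnn) fun h0 => ?_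
  rw [eq_comm, integral_eq_zero_iff_of_nonneg_ae hnn (Integrable.of_bound
    (measurable_massDiff t t').aestronglyMeasurable 2
    (Eventually.of_forall (abs_massDiff_le t t')))] at h0
  obtain ⟨q, hq1, hq2⟩ := (hpos.and h0).exists
  exact hq1.ne' hq2

theorem H_pos_of_lt (hM : M.Assumptions) (hprod : Obs.ProductSupport M.obsLaw) {x x' : Vec k}
    (hx : x ∈ M.suppX) (hx' : x' ∈ M.suppX) (h : M.ν₁ 0 x < M.ν₁ 1 x') :
    0 < Obs.H M.obsLaw x x' := by
  rw [hM.H_eq hprod hx hx']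
  exact hM.integral_massDiff_pos h

theorem H_neg_of_lt (hM : M.Assumptions) (hprod : Obs.ProductSupport M.obsLaw) {x x' : Vec k}
    (hx : x ∈ M.suppX) (hx' : x' ∈ M.suppX) (h : M.ν₁ 1 x' < M.ν₁ 0 x) :
    Obs.H M.obsLaw x x' < 0 := by
  rw [hM.H_eq hprod hx hx', ← neg_pos, ← integral_neg]
  -- `massDiff` is antisymmetric in its two thresholds.
  convert hM.integral_massDiff_pos h using 3 with q
  simp only [massDiff]
  ring

theorem H_eq_zero_of_eq (hM : M.Assumptions) (hprod : Obs.ProductSupport M.obsLaw) {x x' : Vec k}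
    (hx : x ∈ M.suppX) (hx' : x' ∈ M.suppX) (h : M.ν₁ 0 x = M.ν₁ 1 x') :
    Obs.H M.obsLaw x x' = 0 := by
  rw [hM.H_eq hprod hx hx', h]
  simp [massDiff]

theorem H_nonneg_iff (hM : M.Assumptions) (hprod : Obs.ProductSupport M.obsLaw) {x x' : Vec k}
    (hx : x ∈ M.suppX) (hx' : x' ∈ M.suppX) :
    0 ≤ Obs.H M.obsLaw x x' ↔ M.ν₁ 0 x ≤ M.ν₁ 1 x' := by
  refine ⟨fun h => le_of_not_gt fun hlt => ?_, fun h => ?_⟩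
  · exact absurd h (not_le.2 (hM.H_neg_of_lt hprod hx hx' hlt))
  · rcases h.lt_or_eq with h | h
    · exact (hM.H_pos_of_lt hprod hx hx' h).le
    · exact (hM.H_eq_zero_of_eq hprod hx hx' h).ge

theorem H_nonpos_iff (hM : M.Assumptions) (hprod : Obs.ProductSupport M.obsLaw) {x x' : Vec k}
    (hx : x ∈ M.suppX) (hx' : x' ∈ M.suppX) :
    Obs.H M.obsLaw x x' ≤ 0 ↔ M.ν₁ 1 x' ≤ M.ν₁ 0 x := by
  refine ⟨fun h => le_of_not_gt fun hlt => ?_, fun h => ?_⟩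
  · exact absurd h (not_le.2 (hM.H_pos_of_lt hprod hx hx' hlt))
  · rcases h.lt_or_eq with h | h
    · exact (hM.H_neg_of_lt hprod hx hx' h).le
    · exact (hM.H_eq_zero_of_eq hprod hx hx' h.symm).le

/-! ### The SV bounds in terms of the error law -/

/-- Under the product support condition every `p` in Ω_P is admissible at every covariate value, so
the restriction of the inner optimisation is vacuous. -/
theorem wellDef_eq (hM : M.Assumptions) (hprod : Obs.ProductSupport M.obsLaw) {p : ℝ}
    (hp : p ∈ Obs.suppP M.obsLaw) {Q R : Vec k → Prop} (hQR : ∀ x' ∈ M.suppX, (Q x' ↔ R x')) :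
    Obs.wellDef M.obsLaw p {x' ∈ Obs.suppX M.obsLaw | Q x'} = {x' ∈ M.suppX | R x'} := by
  ext x'
  rw [Obs.wellDef, mem_ofPred_eq, mem_ofPred_eq, mem_ofPred_eq, hM.obsLaw_suppX]
  constructor
  · rintro ⟨⟨h1, h2⟩, -⟩
    exact ⟨h1, (hQR x' h1).1 h2⟩
  · rintro ⟨h1, h2⟩
    exact ⟨⟨h1, (hQR x' h1).2 h2⟩, by rw [hM.suppPGiven_eq hprod h1]; exact hp⟩

theorem isCompact_sep_le (hM : M.Assumptions) (d : Fin 2) (t : ℝ) :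
    IsCompact {x' ∈ M.suppX | M.ν₁ d x' ≤ t} :=
  hM.isCompact_suppX.of_isClosed_subset
    ((hM.continuousOn_ν₁ d).preimage_isClosed_of_isClosed M.isClosed_suppX isClosed_Iic)
    (sep_subset _ _)

theorem isCompact_sep_ge (hM : M.Assumptions) (d : Fin 2) (t : ℝ) :
    IsCompact {x' ∈ M.suppX | t ≤ M.ν₁ d x'} :=
  hM.isCompact_suppX.of_isClosed_subset
    ((hM.continuousOn_ν₁ d).preimage_isClosed_of_isClosed M.isClosed_suppX isClosed_Ici)
    (sep_subset _ _)

theorem sup_X1plus (hM : M.Assumptions) (hprod : Obs.ProductSupport M.obsLaw) {x : Vec k}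
    (hx : x ∈ M.suppX) {p : ℝ} (hp : p ∈ Obs.suppP M.obsLaw) :
    supZero ((fun x' => Obs.prYD M.obsLaw 1 0 x' p)
        '' Obs.wellDef M.obsLaw p (Obs.X1plus M.obsLaw x))
      = (highPart M.errLaw p).real (innerRay M.suppX (M.ν₁ 0) (M.ν₁ 1 x)) := by
  rw [Obs.X1plus, hM.wellDef_eq hprod hp fun x' hx' => hM.H_nonneg_iff hprod hx' hx,
    image_congr fun x' hx' => hM.prYD_one_zero hprod hx'.1 hp]
  exact supZero_image_measureReal_Iio (hM.isCompact_sep_le 0 _)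
    ((hM.continuousOn_ν₁ 0).mono (sep_subset _ _)) _

theorem sup_X0minus (hM : M.Assumptions) (hprod : Obs.ProductSupport M.obsLaw) {x : Vec k}
    (hx : x ∈ M.suppX) {p : ℝ} (hp : p ∈ Obs.suppP M.obsLaw) :
    supZero ((fun x' => Obs.prYD M.obsLaw 1 1 x' p)
        '' Obs.wellDef M.obsLaw p (Obs.X0minus M.obsLaw x))
      = (lowPart M.errLaw p).real (innerRay M.suppX (M.ν₁ 1) (M.ν₁ 0 x)) := by
  rw [Obs.X0minus, hM.wellDef_eq hprod hp fun x' hx' => hM.H_nonpos_iff hprod hx hx',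
    image_congr fun x' hx' => hM.prYD_one_one hprod hx'.1 hp]
  exact supZero_image_measureReal_Iio (hM.isCompact_sep_le 1 _)
    ((hM.continuousOn_ν₁ 1).mono (sep_subset _ _)) _

theorem inf_X0plus (hM : M.Assumptions) (hprod : Obs.ProductSupport M.obsLaw) {x : Vec k}
    (hx : x ∈ M.suppX) {p : ℝ} (hp : p ∈ Obs.suppP M.obsLaw) :
    p * infOne ((fun x' => Obs.prYGivenD M.obsLaw 1 1 x' p)
        '' Obs.wellDef M.obsLaw p (Obs.X0plus M.obsLaw x))
      = (lowPart M.errLaw p).real (outerRay M.suppX (M.ν₁ 1) (M.ν₁ 0 x)) := by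
  rw [Obs.X0plus, hM.wellDef_eq hprod hp fun x' hx' => hM.H_nonneg_iff hprod hx hx',
    image_congr fun x' hx' => hM.prYGivenD_one_one hprod hx'.1 hp]
  exact mul_infOne_image_measureReal_Iio_div (hM.isCompact_sep_ge 1 _)
    ((hM.continuousOn_ν₁ 1).mono (sep_subset _ _)) _ (hM.pos_of_mem_suppP hp)
    (hM.lowPart_univ_of_mem_suppP hp)

theorem inf_X1minus (hM : M.Assumptions) (hprod : Obs.ProductSupport M.obsLaw) {x : Vec k}
    (hx : x ∈ M.suppX) {p : ℝ} (hp : p ∈ Obs.suppP M.obsLaw) :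
    (1 - p) * infOne ((fun x' => Obs.prYGivenD M.obsLaw 1 0 x' p)
        '' Obs.wellDef M.obsLaw p (Obs.X1minus M.obsLaw x))
      = (highPart M.errLaw p).real (outerRay M.suppX (M.ν₁ 0) (M.ν₁ 1 x)) := by
  rw [Obs.X1minus, hM.wellDef_eq hprod hp fun x' hx' => hM.H_nonpos_iff hprod hx' hx,
    image_congr fun x' hx' => hM.prYGivenD_one_zero hprod hx'.1 hp]
  exact mul_infOne_image_measureReal_Iio_div (hM.isCompact_sep_ge 0 _)
    ((hM.continuousOn_ν₁ 0).mono (sep_subset _ _)) _ (sub_pos.2 (hM.lt_one_of_mem_suppP hp))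
    (hM.highPart_univ_of_mem_suppP hp)

/-- Both expressions in braces increase with `p`: a larger `p` moves a rank band from the inner ray
to the half-line in the first, and from the half-line to the outer ray in the second. The supremum
is therefore at the highest score and the infimum at the lowest. -/
theorem lowerSV_eq (hM : M.Assumptions) (hprod : Obs.ProductSupport M.obsLaw) {x : Vec k}
    (hx : x ∈ M.suppX) :
    Obs.lowerSV M.obsLaw x
      = ((lowPart M.errLaw (Obs.pHigh M.obsLaw)).real (Iio (M.ν₁ 1 x))
          + (highPart M.errLaw (Obs.pHigh M.obsLaw)).real
            (innerRay M.suppX (M.ν₁ 0) (M.ν₁ 1 x)))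
        - ((lowPart M.errLaw (Obs.pLow M.obsLaw)).real
            (outerRay M.suppX (M.ν₁ 1) (M.ν₁ 0 x))
          + (highPart M.errLaw (Obs.pLow M.obsLaw)).real (Iio (M.ν₁ 0 x))) := by
  rw [Obs.lowerSV, hM.suppPGiven_eq hprod hx]
  congr 1
  · rw [image_congr fun p hp => by rw [hM.prYD_one_one hprod hx hp, hM.sup_X1plus hprod hx hp]]
    exact supZero_image_eq hM.isGreatest_pHigh.1 fun p hp =>
      lowPart_add_highPart_mono measurableSet_Iio measurableSet_innerRay innerRay_subset
        (hM.isGreatest_pHigh.2 hp)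
  · rw [image_congr fun p hp => by
      rw [hM.prYD_one_zero hprod hx hp, hM.inf_X0plus hprod hx hp, add_comm]]
    exact infOne_image_eq hM.isLeast_pLow.1 fun p hp =>
      lowPart_add_highPart_mono measurableSet_outerRay measurableSet_Iio subset_outerRay
        (hM.isLeast_pLow.2 hp)

/-- Inner and outer rays change places relative to the lower bound, so both expressions decrease
with `p`; infimum and supremum stay at the same extreme scores. -/
theorem upperSV_eq (hM : M.Assumptions) (hprod : Obs.ProductSupport M.obsLaw) {x : Vec k}
    (hx : x ∈ M.suppX) :
    Obs.upperSV M.obsLaw x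
      = ((lowPart M.errLaw (Obs.pHigh M.obsLaw)).real (Iio (M.ν₁ 1 x))
          + (highPart M.errLaw (Obs.pHigh M.obsLaw)).real
            (outerRay M.suppX (M.ν₁ 0) (M.ν₁ 1 x)))
        - ((lowPart M.errLaw (Obs.pLow M.obsLaw)).real
            (innerRay M.suppX (M.ν₁ 1) (M.ν₁ 0 x))
          + (highPart M.errLaw (Obs.pLow M.obsLaw)).real (Iio (M.ν₁ 0 x))) := by
  rw [Obs.upperSV, hM.suppPGiven_eq hprod hx]
  congr 1
  · rw [image_congr fun p hp => by rw [hM.prYD_one_one hprod hx hp, hM.inf_X1minus hprod hx hp]]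
    exact infOne_image_eq hM.isGreatest_pHigh.1 fun p hp =>
      lowPart_add_highPart_anti measurableSet_Iio measurableSet_outerRay subset_outerRay
        (hM.isGreatest_pHigh.2 hp)
  · rw [image_congr fun p hp => by
      rw [hM.prYD_one_zero hprod hx hp, hM.sup_X0minus hprod hx hp, add_comm]]
    exact supZero_image_eq hM.isLeast_pLow.1 fun p hp =>
      lowPart_add_highPart_anti measurableSet_innerRay measurableSet_Iio innerRay_subset
        (hM.isLeast_pLow.2 hp)

/-- Split the mass below ν₁(1,x) at the highest score and the mass below ν₁(0,x) at the lowest. The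
bounds differ from the ATE only in replacing a half-line by its inner or outer ray in the unobserved
part. -/
theorem ATE_mem_Icc (hM : M.Assumptions) (hprod : Obs.ProductSupport M.obsLaw) {x : Vec k}
    (hx : x ∈ M.suppX) :
    M.ATE x ∈ Icc (Obs.lowerSV M.obsLaw x) (Obs.upperSV M.obsLaw x) := by
  rw [hM.lowerSV_eq hprod hx, hM.upperSV_eq hprod hx, hM.ATE_eq hx,
    ← lowPart_real_add_highPart_real (Obs.pHigh M.obsLaw) (measurableSet_Iio (a := M.ν₁ 1 x)),
    ← lowPart_real_add_highPart_real (Obs.pLow M.obsLaw) (measurableSet_Iio (a := M.ν₁ 0 x))]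
  exact ⟨sub_le_sub (add_le_add le_rfl (measureReal_mono innerRay_subset))
      (add_le_add (measureReal_mono subset_outerRay) le_rfl),
    sub_le_sub (add_le_add le_rfl (measureReal_mono subset_outerRay))
      (add_le_add (measureReal_mono innerRay_subset) le_rfl)⟩

end Assumptions

/-- The SV bounds shrink when the range of the propensity score grows. -/
theorem bounds_mono_of_extreme_scores {l' : ℕ} {N : SVModel.{v} k l'} (hM : M.Assumptions)
    (hprodM : Obs.ProductSupport M.obsLaw) (hN : N.Assumptions)
    (hprodN : Obs.ProductSupport N.obsLaw) (hsupp : N.suppX = M.suppX)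
    (hν : ∀ d, ∀ x ∈ M.suppX, N.ν₁ d x = M.ν₁ d x) (herr : N.errLaw = M.errLaw)
    (hlow : Obs.pLow N.obsLaw ≤ Obs.pLow M.obsLaw)
    (hhigh : Obs.pHigh M.obsLaw ≤ Obs.pHigh N.obsLaw) {x : Vec k} (hx : x ∈ M.suppX) :
    Obs.lowerSV M.obsLaw x ≤ Obs.lowerSV N.obsLaw x ∧
      Obs.upperSV N.obsLaw x ≤ Obs.upperSV M.obsLaw x := by
  have hxN : x ∈ N.suppX := hsupp ▸ hx
  rw [hM.lowerSV_eq hprodM hx, hM.upperSV_eq hprodM hx, hN.lowerSV_eq hprodN hxN,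
    hN.upperSV_eq hprodN hxN, hsupp, herr, hν 0 x hx, hν 1 x hx, innerRay_congr (hν 0),
    innerRay_congr (hν 1), outerRay_congr (hν 0), outerRay_congr (hν 1)]
  exact ⟨sub_le_sub
      (lowPart_add_highPart_mono measurableSet_Iio measurableSet_innerRay innerRay_subset hhigh)
      (lowPart_add_highPart_mono measurableSet_outerRay measurableSet_Iio subset_outerRay hlow),
    sub_le_sub
      (lowPart_add_highPart_anti measurableSet_Iio measurableSet_outerRay subset_outerRay hhigh)
      (lowPart_add_highPart_anti measurableSet_innerRay measurableSet_Iio innerRay_subset hlow)⟩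

end SVModel

/-! ### Piecewise affine rearrangements -/

/-- A measurable surjection of the line that agrees at each point with one of finitely many
invertible affine maps. -/
structure IsPiecewiseAffine (φ : ℝ → ℝ) : Prop where
  measurable : Measurable φ
  surjective : Function.Surjective φ
  exists_affine : ∃ s : Finset (ℝ × ℝ), (∀ a ∈ s, a.1 ≠ 0) ∧ ∀ e, ∃ a ∈ s, φ e = a.1 * e + a.2

theorem IsPiecewiseAffine.id : IsPiecewiseAffine fun e => e :=
  ⟨measurable_id, fun e => ⟨e, rfl⟩, {(1, 0)}, by simp, by simp⟩

/-- The map that stretches `[c, τ]` to `[c, t]` and `[τ, c']` to `[t, c']`. -/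
noncomputable def stretch (c τ t c' e : ℝ) : ℝ :=
  if e ≤ c ∨ c' ≤ e then e
  else if e < τ then (t - c) / (τ - c) * e + (c - (t - c) / (τ - c) * c)
  else (c' - t) / (c' - τ) * e + (c' - (c' - t) / (c' - τ) * c')

section Stretch

variable {c τ t c' : ℝ}

theorem stretch_of_le {e : ℝ} (h : e ≤ c) : stretch c τ t c' e = e := if_pos (Or.inl h)

theorem stretch_of_ge {e : ℝ} (h : c' ≤ e) : stretch c τ t c' e = e := if_pos (Or.inr h)

theorem stretch_of_mem_left (hτ' : τ < c') {e : ℝ} (h1 : c < e) (h2 : e < τ) :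
    stretch c τ t c' e = c + (t - c) * ((e - c) / (τ - c)) := by
  rw [stretch, if_neg (by simp [h1, h2.trans hτ']), if_pos h2]
  ring

theorem stretch_of_mem_right (hτ : c < τ) {e : ℝ} (h1 : τ ≤ e) (h2 : e < c') :
    stretch c τ t c' e = c' - (c' - t) * ((c' - e) / (c' - τ)) := by
  rw [stretch, if_neg (by simp [hτ.trans_le h1, h2]), if_neg (not_lt.2 h1)]
  ring

theorem stretch_mem_left (hτ' : τ < c') (ht : c < t) {e : ℝ} (h1 : c < e) (h2 : e < τ) :
    stretch c τ t c' e ∈ Ioo c t := by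
  rw [stretch_of_mem_left hτ' h1 h2]
  have h3 : 0 < (e - c) / (τ - c) := div_pos (by linarith) (by linarith)
  have h4 : (e - c) / (τ - c) < 1 := (div_lt_one (by linarith)).2 (by linarith)
  have h5 : 0 < t - c := by linarith
  constructor
  · nlinarith [mul_pos h5 h3]
  · nlinarith [mul_lt_mul_of_pos_left h4 h5]

theorem stretch_mem_right (hτ : c < τ) (ht' : t < c') {e : ℝ} (h1 : τ ≤ e) (h2 : e < c') :
    stretch c τ t c' e ∈ Ico t c' := by
  rw [stretch_of_mem_right hτ h1 h2]
  have h3 : 0 < (c' - e) / (c' - τ) := div_pos (by linarith) (by linarith)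
  have h4 : (c' - e) / (c' - τ) ≤ 1 := (div_le_one (by linarith)).2 (by linarith)
  have h5 : 0 < c' - t := by linarith
  constructor
  · nlinarith [mul_le_mul_of_nonneg_left h4 h5.le]
  · nlinarith [mul_pos h5 h3]

theorem stretch_lt_iff (hτ : c < τ) (hτ' : τ < c') (ht : c < t) (ht' : t < c') (e : ℝ) :
    stretch c τ t c' e < t ↔ e < τ := by
  rcases le_or_gt e c with h | h
  · rw [stretch_of_le h]
    exact ⟨fun _ => by linarith, fun _ => by linarith⟩
  rcases le_or_gt c' e with h' | h'
  · rw [stretch_of_ge h']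
    exact ⟨fun _ => by linarith, fun _ => by linarith⟩
  rcases lt_or_ge e τ with h'' | h''
  · exact iff_of_true (stretch_mem_left hτ' ht h h'').2 h''
  · exact iff_of_false (not_lt.2 (stretch_mem_right hτ ht' h'' h').1) (not_lt.2 h'')

theorem stretch_lt_iff_of_notMem (hτ : c < τ) (hτ' : τ < c') (ht : c < t) (ht' : t < c') {s : ℝ}
    (hs : s ≤ c ∨ c' ≤ s) (e : ℝ) : stretch c τ t c' e < s ↔ e < s := by
  rcases le_or_gt e c with h | h
  · rw [stretch_of_le h]
  rcases le_or_gt c' e with h' | h'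
  · rw [stretch_of_ge h']
  have h3 : c < stretch c τ t c' e ∧ stretch c τ t c' e < c' := by
    rcases lt_or_ge e τ with h'' | h''
    · have := stretch_mem_left hτ' ht h h''
      exact ⟨this.1, this.2.trans ht'⟩
    · have := stretch_mem_right hτ ht' h'' h'
      exact ⟨ht.trans_le this.1, this.2⟩
  rcases hs with hs | hs
  · exact iff_of_false (by linarith) (by linarith)
  · exact iff_of_true (by linarith) (by linarith)

theorem isPiecewiseAffine_stretch (hτ : c < τ) (hτ' : τ < c') (ht : c < t) (ht' : t < c') :
    IsPiecewiseAffine (stretch c τ t c') := by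
  have h1 : 0 < τ - c := sub_pos.2 hτ
  have h2 : 0 < c' - τ := sub_pos.2 hτ'
  have h3 : 0 < t - c := sub_pos.2 ht
  have h4 : 0 < c' - t := sub_pos.2 ht'
  refine ⟨?_, fun y => ?_, {(1, 0), ((t - c) / (τ - c), c - (t - c) / (τ - c) * c),
    ((c' - t) / (c' - τ), c' - (c' - t) / (c' - τ) * c')}, ?_, fun e => ?_⟩
  · refine Measurable.ite (measurableSet_Iic.union measurableSet_Ici) measurable_id
      (Measurable.ite measurableSet_Iio (by fun_prop) (by fun_prop))
  · rcases le_or_gt y c with h | h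
    · exact ⟨y, stretch_of_le h⟩
    rcases le_or_gt c' y with h' | h'
    · exact ⟨y, stretch_of_ge h'⟩
    rcases lt_or_ge y t with h'' | h''
    · have h5 : 0 < (y - c) / (t - c) := div_pos (by linarith) h3
      have h6 : (y - c) / (t - c) < 1 := (div_lt_one h3).2 (by linarith)
      refine ⟨c + (τ - c) * ((y - c) / (t - c)), ?_⟩
      rw [stretch_of_mem_left hτ' (by nlinarith [mul_pos h1 h5])
        (by nlinarith [mul_lt_mul_of_pos_left h6 h1])]
      field_simp
      ring
    · have h5 : 0 < (c' - y) / (c' - t) := div_pos (by linarith) h4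
      have h6 : (c' - y) / (c' - t) ≤ 1 := (div_le_one h4).2 (by linarith)
      refine ⟨c' - (c' - τ) * ((c' - y) / (c' - t)), ?_⟩
      rw [stretch_of_mem_right hτ (by nlinarith [mul_le_mul_of_nonneg_left h6 h2.le])
        (by nlinarith [mul_pos h2 h5])]
      field_simp
      ring
  · intro a ha
    simp only [Finset.mem_insert, Finset.mem_singleton] at ha
    rcases ha with rfl | rfl | rfl
    · exact one_ne_zero
    · exact (div_pos h3 h1).ne'
    · exact (div_pos h4 h2).ne'
  · rw [stretch]
    split_ifs
    · exact ⟨(1, 0), by simp, by simp⟩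
    · exact ⟨((t - c) / (τ - c), c - (t - c) / (τ - c) * c), by simp, rfl⟩
    · exact ⟨((c' - t) / (c' - τ), c' - (c' - t) / (c' - τ) * c'), by simp, rfl⟩

end Stretch

/-- A closed set that avoids two points and everything between them avoids a neighbourhood. -/
theorem IsClosed.exists_gap {T : Set ℝ} (hT : IsClosed T) {a b : ℝ}
    (h : ∀ s ∈ T, (s < a ∧ s < b) ∨ (a < s ∧ b < s)) :
    ∃ c c', c < a ∧ c < b ∧ a < c' ∧ b < c' ∧ ∀ s ∈ T, s ≤ c ∨ c' ≤ s := by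
  have hmin : min a b ∉ T := fun hs => by
    rcases h _ hs with h | h
    · exact absurd (lt_min h.1 h.2) (lt_irrefl _)
    · exact absurd (lt_of_lt_of_le h.1 (min_le_left a b)) (lt_irrefl _)
  have hmax : max a b ∉ T := fun hs => by
    rcases h _ hs with h | h
    · exact absurd (lt_of_le_of_lt (le_max_left a b) h.1) (lt_irrefl _)
    · exact absurd (max_lt h.1 h.2) (lt_irrefl _)
  obtain ⟨c, hc, hcT⟩ := exists_Ioc_subset_of_mem_nhds (hT.isOpen_compl.mem_nhds hmin)
    (exists_lt _)
  obtain ⟨c', hc', hcT'⟩ := exists_Ico_subset_of_mem_nhds (hT.isOpen_compl.mem_nhds hmax)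
    (exists_gt _)
  obtain ⟨h1, h2⟩ := lt_min_iff.1 hc
  obtain ⟨h3, h4⟩ := max_lt_iff.1 hc'
  refine ⟨c, c', h1, h2, h3, h4, fun s hs => ?_⟩
  rcases h s hs with h | h
  · exact Or.inl (le_of_not_gt fun hcs => hcT ⟨hcs, (lt_min h.1 h.2).le⟩ hs)
  · exact Or.inr (le_of_not_gt fun hcs => hcT' ⟨(max_lt h.1 h.2).le, hcs⟩ hs)

/-- The mass below a threshold can be moved to any value between the masses of the neighbouring
values of `f`, without changing the order relative to the values of `f`. -/
theorem exists_rearrangement {E : Type*} [TopologicalSpace E] {K : Set E} (hK : IsCompact K)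
    {f : E → ℝ} (hf : ContinuousOn f K) (κ : Measure ℝ) [IsFiniteMeasure κ]
    [NullSingletonClass κ] (t : ℝ) {θ : ℝ} (hθ : 0 < θ) (hθ' : θ < 1) :
    ∃ φ : ℝ → ℝ, IsPiecewiseAffine φ ∧ (∀ x ∈ K, ∀ e, φ e < f x ↔ e < f x) ∧
      κ.real (φ ⁻¹' Iio t)
        = (1 - θ) * κ.real (innerRay K f t) + θ * κ.real (outerRay K f t) := by
  have h1 : κ.real (innerRay K f t) ≤ κ.real (Iio t) := measureReal_mono innerRay_subset
  have h2 : κ.real (Iio t) ≤ κ.real (outerRay K f t) := measureReal_mono subset_outerRay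
  rcases (h1.trans h2).eq_or_lt with heq | hlt
  -- If inner and outer masses agree, the half-line below `t` already has that mass and nothing
  -- needs to move.
  · refine ⟨fun e => e, IsPiecewiseAffine.id, fun _ _ _ => Iff.rfl, ?_⟩
    have h3 : κ.real ((fun e : ℝ => e) ⁻¹' Iio t) = κ.real (Iio t) := rfl
    have h4 : κ.real (Iio t) = κ.real (outerRay K f t) := le_antisymm h2 (heq ▸ h1)
    rw [h3, heq, h4]
    ring
  · set v := (1 - θ) * κ.real (innerRay K f t) + θ * κ.real (outerRay K f t) with hv
    have hv1 : κ.real (innerRay K f t) < v := by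
      rw [hv]; nlinarith
    have hv2 : v < κ.real (outerRay K f t) := by
      rw [hv]; nlinarith
    -- `τ` is a quantile: the half-line below it has the target mass. The map to be built carries
    -- `τ` to `t`.
    obtain ⟨τ, hτ⟩ : v ∈ range fun s => κ.real (Iio s) :=
      mem_range_of_exists_le_of_exists_ge (continuous_measureReal_Iio κ)
        ((tendsto_measureReal_Iio_atBot κ).eventually_le_const
          (measureReal_nonneg.trans_lt hv1)).exists
        ((tendsto_measureReal_Iio_atTop κ).eventually_const_le
          (hv2.trans_le (measureReal_mono (subset_univ _)))).exists
    have hin : ∀ x ∈ K, f x ≤ t → κ.real (Iio (f x)) ≤ κ.real (innerRay K f t) :=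
      fun x hx hxt => measureReal_mono (subset_iUnion₂_of_subset x ⟨hx, hxt⟩ subset_rfl)
    have hout : ∀ x ∈ K, t ≤ f x → κ.real (outerRay K f t) ≤ κ.real (Iio (f x)) :=
      fun x hx hxt => measureReal_mono (iInter₂_subset x ⟨hx, hxt⟩)
    -- Since `v` lies strictly between the inner and outer masses, no value of `f` equals or
    -- separates `τ` and `t`. The value `t` itself is excluded because it would make the two masses
    -- equal. So both points lie in one gap of the closed set `f '' K`, with room for a stretch.
    have hsep : ∀ s ∈ f '' K, (s < τ ∧ s < t) ∨ (τ < s ∧ t < s) := by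
      rintro _ ⟨x, hx, rfl⟩
      rcases lt_trichotomy (f x) t with h | h | h
      · refine Or.inl ⟨lt_of_not_ge fun hle => ?_, h⟩
        have h3 : v ≤ κ.real (Iio (f x)) := hτ ▸ measureReal_mono (Iio_subset_Iio hle)
        linarith [hin x hx h.le]
      · linarith [hin x hx h.le, hout x hx h.ge]
      · refine Or.inr ⟨lt_of_not_ge fun hle => ?_, h⟩
        have h3 : κ.real (Iio (f x)) ≤ v := hτ ▸ measureReal_mono (Iio_subset_Iio hle)
        linarith [hout x hx h.le]
    obtain ⟨c, c', h3, h4, h5, h6, hgap⟩ :=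
      (hK.image_of_continuousOn hf).isClosed.exists_gap hsep
    refine ⟨stretch c τ t c', isPiecewiseAffine_stretch h3 h5 h4 h6,
      fun x hx e => stretch_lt_iff_of_notMem h3 h5 h4 h6 (hgap _ (mem_image_of_mem f hx)) e, ?_⟩
    rw [← hτ]
    congr 1
    ext e
    exact stretch_lt_iff h3 h5 h4 h6 e

/-! ### Equivalence with Lebesgue measure -/

theorem volume_preimage_affine_fst {a b : ℝ} (ha : a ≠ 0) {s : Set (ℝ × ℝ)}
    (h : volume s = 0) : volume ((fun e : ℝ × ℝ => (a * e.1 + b, e.2)) ⁻¹' s) = 0 := by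
  have h1 : (volume : Measure ℝ).map (fun x => a * x + b) ≪ volume := by
    have : (fun x : ℝ => a * x + b) = (fun x => x + b) ∘ fun x => a * x := rfl
    rw [this, ← Measure.map_map (by fun_prop) (by fun_prop), Real.map_volume_mul_left ha,
      Measure.map_smul, map_add_right_eq_self]
    exact Measure.smul_absolutelyContinuous
  have h2 : (volume : Measure (ℝ × ℝ)).map (fun e => (a * e.1 + b, e.2)) ≪ volume := by
    rw [Measure.volume_eq_prod, show (fun e : ℝ × ℝ => (a * e.1 + b, e.2))
      = Prod.map (fun x => a * x + b) id from rfl,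
      ← Measure.map_prod_map _ _ (by fun_prop) measurable_id, Measure.map_id]
    exact h1.prod Measure.AbsolutelyContinuous.rfl
  exact Measure.QuasiMeasurePreserving.preimage_null ⟨by fun_prop, h2⟩ h

/-- Finitely many affine branches with nonzero slope pull null sets back to null sets. For the
converse, surjectivity takes the place of injectivity. -/
theorem map_absolutelyContinuous_of_affine {lam : Measure (ℝ × ℝ)} (hac : lam ≪ volume)
    (hca : volume ≪ lam) {T : ℝ × ℝ → ℝ × ℝ} (hT : Measurable T) (hsurj : Function.Surjective T)
    {s : Finset (ℝ × ℝ)} (hs : ∀ a ∈ s, a.1 ≠ 0)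
    (hTs : ∀ e, ∃ a ∈ s, T e = (a.1 * e.1 + a.2, e.2)) :
    lam.map T ≪ volume ∧ volume ≪ lam.map T := by
  constructor
  · refine Measure.AbsolutelyContinuous.mk fun N hN h0 => ?_
    rw [Measure.map_apply hT hN]
    refine hac (measure_mono_null (t := ⋃ a ∈ s, (fun e : ℝ × ℝ => (a.1 * e.1 + a.2, e.2)) ⁻¹' N)
      (fun e he => ?_) ((measure_biUnion_null_iff s.countable_toSet).2 fun a ha =>
        volume_preimage_affine_fst (hs a ha) h0))
    obtain ⟨a, ha, hTe⟩ := hTs e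
    rw [mem_preimage, hTe] at he
    exact mem_iUnion₂.2 ⟨a, ha, he⟩
  · refine Measure.AbsolutelyContinuous.mk fun N hN h0 => ?_
    rw [Measure.map_apply hT hN] at h0
    -- Each point of `N` is `T e` for some `e`, and inverting the branch active at `e` returns a
    -- point of the null set `T ⁻¹' N`. Hence the preimages of that set under the inverse branches
    -- cover `N`.
    refine measure_mono_null (t := ⋃ a ∈ s,
      (fun e : ℝ × ℝ => (a.1⁻¹ * e.1 + -(a.1⁻¹ * a.2), e.2)) ⁻¹' (T ⁻¹' N))
      (fun y hy => ?_) ((measure_biUnion_null_iff s.countable_toSet).2 fun a ha =>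
        volume_preimage_affine_fst (inv_ne_zero (hs a ha)) (hca h0))
    obtain ⟨e, rfl⟩ := hsurj y
    obtain ⟨a, ha, hTe⟩ := hTs e
    refine mem_iUnion₂.2 ⟨a, ha, ?_⟩
    have hae : (a.1⁻¹ * (T e).1 + -(a.1⁻¹ * a.2), (T e).2) = e := by
      rw [hTe]
      ext
      · have := hs a ha
        field_simp
        ring
      · rfl
    change T (a.1⁻¹ * (T e).1 + -(a.1⁻¹ * a.2), (T e).2) ∈ N
    rw [hae]
    exact hy

/-- The Radon–Nikodym derivative is positive only almost everywhere; on its null zero set the value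
is reset to 1. -/
theorem exists_positive_density {lam : Measure (ℝ × ℝ)} [IsFiniteMeasure lam]
    (hac : lam ≪ volume) (hca : volume ≪ lam) :
    ∃ f : ℝ × ℝ → ENNReal, Measurable f ∧ (∀ e, 0 < f e) ∧ lam = volume.withDensity f := by
  classical
  have hm := Measure.measurable_rnDeriv lam volume
  refine ⟨fun e => if lam.rnDeriv volume e = 0 then 1 else lam.rnDeriv volume e,
    Measurable.ite (hm (measurableSet_singleton 0)) measurable_const hm, fun e => ?_, ?_⟩
  · dsimp only
    split_ifs with h
    · exact one_pos
    · exact pos_iff_ne_zero.2 h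
  · conv_lhs => rw [← Measure.withDensity_rnDeriv_eq lam volume hac]
    refine withDensity_congr_ae ?_
    filter_upwards [Measure.rnDeriv_pos' hca] with e he
    rw [if_neg he.ne']

/-! ### Rearrangement of the error law outside the range of the propensity score -/

/-- Rearranges the first coordinate by `φ` where the rank of the second one is at least `p'`, and
by `ψ` where it is below `p`. -/
noncomputable def rearrange (lam : Measure (ℝ × ℝ)) (p p' : ℝ) (φ ψ : ℝ → ℝ) (e : ℝ × ℝ) :
    ℝ × ℝ :=
  open Classical in
  if p' ≤ errCdf lam e.2 then (φ e.1, e.2) else if errCdf lam e.2 < p then (ψ e.1, e.2) else e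

section Rearrange

variable {lam : Measure (ℝ × ℝ)} {p p' : ℝ} {φ ψ : ℝ → ℝ}

theorem rearrange_snd (e : ℝ × ℝ) : (rearrange lam p p' φ ψ e).2 = e.2 := by
  unfold rearrange
  split_ifs <;> rfl

theorem rearrange_of_le {e : ℝ × ℝ} (h : p' ≤ errCdf lam e.2) :
    (rearrange lam p p' φ ψ e).1 = φ e.1 := by
  rw [rearrange, if_pos h]

theorem rearrange_of_lt (hp : p ≤ p') {e : ℝ × ℝ} (h : errCdf lam e.2 < p) :
    (rearrange lam p p' φ ψ e).1 = ψ e.1 := by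
  rw [rearrange, if_neg (not_le.2 (h.trans_le hp)), if_pos h]

/-- Thresholds that `φ` respects are not affected above the rank `p`. -/
theorem rearrange_fst_lt_iff_of_le {s : ℝ} (hφ : ∀ e, φ e < s ↔ e < s) {e : ℝ × ℝ}
    (h : p ≤ errCdf lam e.2) : (rearrange lam p p' φ ψ e).1 < s ↔ e.1 < s := by
  unfold rearrange
  split_ifs with h1 h2
  · exact hφ e.1
  · exact absurd h (not_le.2 h2)
  · exact Iff.rfl

/-- Thresholds that `ψ` respects are not affected below the rank `p'`. -/
theorem rearrange_fst_lt_iff_of_lt {s : ℝ} (hψ : ∀ e, ψ e < s ↔ e < s) {e : ℝ × ℝ}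
    (h : errCdf lam e.2 < p') : (rearrange lam p p' φ ψ e).1 < s ↔ e.1 < s := by
  unfold rearrange
  split_ifs with h1 h2
  · exact absurd h1 (not_le.2 h)
  · exact hψ e.1
  · exact Iff.rfl

variable [IsProbabilityMeasure lam]

theorem measurable_rearrange (hφ : IsPiecewiseAffine φ) (hψ : IsPiecewiseAffine ψ) :
    Measurable (rearrange lam p p' φ ψ) := by
  classical
  exact Measurable.ite (measurableSet_le_errCdf p')
    ((hφ.measurable.comp measurable_fst).prodMk measurable_snd)
    (Measurable.ite (measurableSet_errCdf_lt p)
      ((hψ.measurable.comp measurable_fst).prodMk measurable_snd) measurable_id)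

theorem map_rearrange_absolutelyContinuous (hac : lam ≪ volume) (hca : volume ≪ lam)
    (hφ : IsPiecewiseAffine φ) (hψ : IsPiecewiseAffine ψ) :
    lam.map (rearrange lam p p' φ ψ) ≪ volume ∧ volume ≪ lam.map (rearrange lam p p' φ ψ) := by
  obtain ⟨s, hs, hsφ⟩ := hφ.exists_affine
  obtain ⟨s', hs', hsψ⟩ := hψ.exists_affine
  refine map_absolutelyContinuous_of_affine hac hca (measurable_rearrange hφ hψ) ?_
    (s := insert (1, 0) (s ∪ s')) ?_ ?_
  · rintro ⟨y, z⟩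
    by_cases h1 : p' ≤ errCdf lam z
    · obtain ⟨e, rfl⟩ := hφ.surjective y
      exact ⟨(e, z), by rw [rearrange, if_pos h1]⟩
    · by_cases h2 : errCdf lam z < p
      · obtain ⟨e, rfl⟩ := hψ.surjective y
        exact ⟨(e, z), by rw [rearrange, if_neg h1, if_pos h2]⟩
      · exact ⟨(y, z), by rw [rearrange, if_neg h1, if_neg h2]⟩
  · intro a ha
    rcases Finset.mem_insert.1 ha with rfl | ha
    · exact one_ne_zero
    · rcases Finset.mem_union.1 ha with ha | ha
      exacts [hs a ha, hs' a ha]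
  · intro e
    unfold rearrange
    split_ifs
    · obtain ⟨a, ha, hae⟩ := hsφ e.1
      exact ⟨a, Finset.mem_insert_of_mem (Finset.mem_union_left _ ha), by rw [hae]⟩
    · obtain ⟨a, ha, hae⟩ := hsψ e.1
      exact ⟨a, Finset.mem_insert_of_mem (Finset.mem_union_right _ ha), by rw [hae]⟩
    · exact ⟨(1, 0), Finset.mem_insert_self _ _, by simp⟩

/-- As `ψ` respects `t`, only the ranks from `p'` upwards can change sides of it. With the companion
lemma for `ψ`, this lets the masses below ν₁(1,x) and ν₁(0,x) be adjusted independently. -/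
theorem map_rearrange_Iio_of_right (hφ : IsPiecewiseAffine φ) (hψ : IsPiecewiseAffine ψ) {t : ℝ}
    (hψt : ∀ e, ψ e < t ↔ e < t) :
    ((lam.map (rearrange lam p p' φ ψ)).map Prod.fst).real (Iio t)
      = (lowPart lam p').real (Iio t) + (highPart lam p').real (φ ⁻¹' Iio t) := by
  rw [map_measureReal_apply measurable_fst measurableSet_Iio,
    map_measureReal_apply (measurable_rearrange hφ hψ) (measurable_fst measurableSet_Iio),
    lowPart_real_apply measurableSet_Iio, highPart_real_apply (hφ.measurable measurableSet_Iio),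
    ← measureReal_inter_add_sdiff (measurableSet_errCdf_lt (lam := lam) p')]
  congr 2
  · ext e
    exact and_congr_left fun h => rearrange_fst_lt_iff_of_lt hψt h
  · ext e
    simp only [Set.mem_sdiff, mem_preimage, mem_ofPred_eq, not_lt]
    exact and_congr_left fun h => by rw [rearrange_of_le h]

theorem map_rearrange_Iio_of_left (hφ : IsPiecewiseAffine φ) (hψ : IsPiecewiseAffine ψ) {t : ℝ}
    (hp : p ≤ p') (hφt : ∀ e, φ e < t ↔ e < t) :
    ((lam.map (rearrange lam p p' φ ψ)).map Prod.fst).real (Iio t)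
      = (lowPart lam p).real (ψ ⁻¹' Iio t) + (highPart lam p).real (Iio t) := by
  rw [map_measureReal_apply measurable_fst measurableSet_Iio,
    map_measureReal_apply (measurable_rearrange hφ hψ) (measurable_fst measurableSet_Iio),
    lowPart_real_apply (hψ.measurable measurableSet_Iio), highPart_real_apply measurableSet_Iio,
    ← measureReal_inter_add_sdiff (measurableSet_errCdf_lt (lam := lam) p)]
  congr 2
  · ext e
    refine and_congr_left fun h => ?_
    rw [mem_preimage, mem_preimage, rearrange_of_lt hp h]
    rfl
  · ext e
    simp only [Set.mem_sdiff, mem_preimage, mem_ofPred_eq, not_lt]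
    exact and_congr_left fun h => rearrange_fst_lt_iff_of_le hφt h

end Rearrange

/-! ### Competing models and sharpness -/

namespace SVModel

variable {k l : ℕ}

/-- The model on the canonical probability space in which the error terms are transformed
by `T`. -/
noncomputable def withErr (M : SVModel.{u} k l) (T : ℝ × ℝ → ℝ × ℝ) (hT : Measurable T) :
    SVModel.{0} k l where
  Ω := (Vec k × Vec l) × (ℝ × ℝ)
  μ := M.lawXZ.prod M.errLaw
  X a := a.1.1
  Z a := a.1.2
  ε₁ a := (T a.2).1
  ε₂ a := (T a.2).2
  measurable_X := by fun_prop
  measurable_Z := by fun_prop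
  measurable_ε₁ := by fun_prop
  measurable_ε₂ := by fun_prop
  ν₁ := M.ν₁
  ν₂ := M.ν₂

variable {M : SVModel.{u} k l} {T : ℝ × ℝ → ℝ × ℝ} {hT : Measurable T}

theorem withErr_lawXZ : (M.withErr T hT).lawXZ = M.lawXZ := by
  change (M.lawXZ.prod M.errLaw).map Prod.fst = M.lawXZ
  rw [Measure.map_fst_prod, measure_univ, one_smul]

theorem withErr_errLaw : (M.withErr T hT).errLaw = M.errLaw.map T := by
  change (M.lawXZ.prod M.errLaw).map (T ∘ Prod.snd) = M.errLaw.map T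
  rw [← Measure.map_map hT measurable_snd, Measure.map_snd_prod, measure_univ, one_smul]

theorem map_X_eq_map_lawXZ (M : SVModel.{u} k l) : M.μ.map M.X = M.lawXZ.map Prod.fst := by
  rw [lawXZ, Measure.map_map measurable_fst M.measurable_XZ]
  rfl

theorem withErr_suppXZ : (M.withErr T hT).suppXZ = M.suppXZ :=
  congrArg Measure.support (withErr_lawXZ (hT := hT))

theorem withErr_suppX : (M.withErr T hT).suppX = M.suppX := by
  rw [suppX, suppX, map_X_eq_map_lawXZ, map_X_eq_map_lawXZ, withErr_lawXZ]

namespace Assumptions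

theorem withErr (hM : M.Assumptions) (hac : M.errLaw.map T ≪ volume)
    (hca : volume ≪ M.errLaw.map T) : (M.withErr T hT).Assumptions where
  density := by
    rw [withErr_errLaw]
    exact exists_positive_density hac hca
  indep := indepFun_prod (X := fun w : Vec k × Vec l => (w.1, w.2))
    (Y := fun e => ((T e).1, (T e).2)) (by fun_prop) (by fun_prop)
  nondegenerate := by
    have hν : AEMeasurable (fun w : Vec k × Vec l => M.ν₂ w.1 w.2) M.lawXZ := by
      refine ⟨M.index₂, hM.measurable_index₂, ?_⟩
      filter_upwards [show M.suppXZ ∈ ae M.lawXZ from Measure.support_mem_ae] with w hw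
      exact (M.index₂_of_mem hw).symm
    -- The conditional law of ν₂(X, Z) given X depends only on the law of (X, Z), so it is carried
    -- to that law by `h1` and to the product space by `h2`.
    have h1 := condDistrib_map (ν := M.μ) (f := M.XZ) (X := Prod.fst)
      (Y := fun w : Vec k × Vec l => M.ν₂ w.1 w.2) measurable_fst.aemeasurable hν
      M.measurable_XZ.aemeasurable
    have h2 := condDistrib_fst_prod (mβ := inferInstance) (X := Prod.fst) hν M.errLaw
    have hlaw : (SVModel.withErr M T hT).μ.map (SVModel.withErr M T hT).X = M.μ.map M.X := by
      rw [map_X_eq_map_lawXZ, map_X_eq_map_lawXZ, withErr_lawXZ]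
    have h3 := hM.nondegenerate
    rw [hlaw]
    rw [← map_X_eq_map_lawXZ] at h2
    filter_upwards [h1, h2, h3] with x hx1 hx2 hx3 c hc
    refine hx3 c ?_
    rw [← hc]
    exact hx1.symm.trans hx2.symm
  compact := by
    rw [withErr_suppXZ]
    exact hM.compact
  continuous_ν₁ := by
    have h := hM.continuous_ν₁
    rw [hM.suppDX_eq] at h
    refine h.mono ?_
    -- Measurability of the new treatment is not needed: without it the pushforward is zero by
    -- convention and its support is empty.
    by_cases hD : AEMeasurable
      (fun ω => ((SVModel.withErr M T hT).D ω, (SVModel.withErr M T hT).X ω))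
      (SVModel.withErr M T hT).μ
    · refine Measure.support_subset_of_isClosed (M.isClosed_suppX.preimage continuous_snd) ?_
      refine (mem_ae_map_iff hD (M.isClosed_suppX.preimage continuous_snd).measurableSet).2 ?_
      filter_upwards [(SVModel.withErr M T hT).ae_mem_suppX] with ω hω
      rwa [withErr_suppX] at hω
    · rw [suppDX, Measure.map_of_not_aemeasurable hD, Measure.support_zero]
      exact empty_subset _
  continuous_ν₂ := by
    rw [withErr_suppXZ]
    exact hM.continuous_ν₂

theorem withErr_id (hM : M.Assumptions) : (M.withErr id measurable_id).Assumptions :=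
  hM.withErr (by rw [Measure.map_id]; exact hM.errLaw_ac)
    (by rw [Measure.map_id]; exact hM.ac_errLaw)

/-- The canonical version of a model generates the same observed data. -/
theorem withErr_id_obsLaw (hM : M.Assumptions) :
    (M.withErr id measurable_id).obsLaw = M.obsLaw := by
  have h : AEMeasurable (fun a => (((M.withErr id measurable_id).Y a,
      (M.withErr id measurable_id).D a, (M.withErr id measurable_id).X a,
      (M.withErr id measurable_id).Z a) : Obs k l)) (M.lawXZ.prod M.errLaw) :=
    hM.withErr_id.aemeasurable_obs
  change (M.lawXZ.prod M.errLaw).map _ = _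
  rw [← hM.map_XZ_err] at h ⊢
  exact AEMeasurable.map_map_of_aemeasurable h
    (M.measurable_XZ.prodMk M.measurable_err).aemeasurable

/-- The identified set ranges over models on spaces in `Type`, so the given model is represented by
its canonical copy. -/
theorem ATE_mem_identifiedSet (hM : M.Assumptions) {x : Vec k} (hx : x ∈ M.suppX) :
    M.ATE x ∈ identifiedSet M.obsLaw x := by
  refine ⟨M.withErr id measurable_id, hM.withErr_id, hM.withErr_id_obsLaw, ?_⟩
  rw [hM.ATE_eq hx, hM.withErr_id.ATE_eq (by rwa [withErr_suppX]), withErr_errLaw, Measure.map_id]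
  rfl

/-- Rearranging the first error term outside the range of the propensity score does not affect the
observed data, if the order relative to the relevant thresholds is kept. -/
theorem withErr_rearrange_obsLaw (hM : M.Assumptions) {φ ψ : ℝ → ℝ}
    (hφK : ∀ x ∈ M.suppX, ∀ e, φ e < M.ν₁ 0 x ↔ e < M.ν₁ 0 x)
    (hψK : ∀ x ∈ M.suppX, ∀ e, ψ e < M.ν₁ 1 x ↔ e < M.ν₁ 1 x)
    (hT : Measurable (rearrange M.errLaw (Obs.pLow M.obsLaw) (Obs.pHigh M.obsLaw) φ ψ)) :
    (M.withErr _ hT).obsLaw = M.obsLaw := by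
  refine Eq.trans ?_ hM.withErr_id_obsLaw
  set T := rearrange M.errLaw (Obs.pLow M.obsLaw) (Obs.pHigh M.obsLaw) φ ψ with hTdef
  have hD : ∀ a, (M.withErr T hT).D a = (M.withErr id measurable_id).D a := by
    intro a
    change (if M.ν₂ a.1.1 a.1.2 > (T a.2).2 then (1 : Fin 2) else 0)
      = if M.ν₂ a.1.1 a.1.2 > a.2.2 then 1 else 0
    rw [hTdef, rearrange_snd]
  have hP : ∀ᵐ w ∂M.lawXZ, M.score w ∈ Obs.suppP M.obsLaw := by
    refine ae_of_ae_map hM.measurable_score.aemeasurable ?_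
    rw [← hM.lawP_eq]
    exact Measure.support_mem_ae
  have hX : ∀ᵐ w ∂M.lawXZ, w.1 ∈ M.suppX := by
    refine ae_of_ae_map measurable_fst.aemeasurable ?_
    rw [← map_X_eq_map_lawXZ]
    exact Measure.support_mem_ae
  have hY : ∀ᵐ a ∂(M.lawXZ.prod M.errLaw),
      (M.withErr T hT).Y a = (M.withErr id measurable_id).Y a := by
    filter_upwards [Measure.quasiMeasurePreserving_fst.ae hP,
      Measure.quasiMeasurePreserving_fst.ae hX,
      Measure.quasiMeasurePreserving_fst.ae
        (show ∀ᵐ w ∂M.lawXZ, w ∈ M.suppXZ from Measure.support_mem_ae)] with a ha1 ha2 ha3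
    change (if M.ν₁ ((M.withErr T hT).D a) a.1.1 > (T a.2).1 then (1 : Fin 2) else 0)
      = if M.ν₁ ((M.withErr id measurable_id).D a) a.1.1 > a.2.1 then 1 else 0
    rw [hD]
    have hDa : (M.withErr id measurable_id).D a
        = if M.ν₂ a.1.1 a.1.2 > a.2.2 then (1 : Fin 2) else 0 := rfl
    have hscore : M.score a.1 = errCdf M.errLaw (M.ν₂ a.1.1 a.1.2) := by
      rw [score, M.index₂_of_mem ha3]
    -- If D = 1, the rank is below the score and so below the highest score: at most `ψ` acts, and
    -- it respects ν₁(1,·). If D = 0, the rank is at least the lowest score: at most `φ` acts, and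
    -- it respects ν₁(0,·).
    have key : M.ν₁ ((M.withErr id measurable_id).D a) a.1.1 > (T a.2).1
        ↔ M.ν₁ ((M.withErr id measurable_id).D a) a.1.1 > a.2.1 := by
      by_cases h : M.ν₂ a.1.1 a.1.2 > a.2.2
      · rw [hDa, if_pos h]
        refine rearrange_fst_lt_iff_of_lt (hψK _ ha2) ?_
        have h' := strictMono_errCdf hM.ac_errLaw h
        rw [← hscore] at h'
        exact h'.trans_le (hM.isGreatest_pHigh.2 ha1)
      · rw [hDa, if_neg h]
        refine rearrange_fst_lt_iff_of_le (hφK _ ha2) ?_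
        have h' := monotone_errCdf (lam := M.errLaw) (not_lt.1 h)
        rw [← hscore] at h'
        exact (hM.isLeast_pLow.2 ha1).trans h'
    simp only [key]
  refine Measure.map_congr ?_
  filter_upwards [hY] with a ha
  rw [ha, hD]
  rfl

/-- Every value strictly between the SV bounds is the average treatment effect in a model with the
same observed data. -/
theorem Ioo_subset_identifiedSet (hM : M.Assumptions) (hprod : Obs.ProductSupport M.obsLaw)
    {x : Vec k} (hx : x ∈ M.suppX) :
    Ioo (Obs.lowerSV M.obsLaw x) (Obs.upperSV M.obsLaw x) ⊆ identifiedSet M.obsLaw x := by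
  rintro s ⟨hs1, hs2⟩
  set L := Obs.lowerSV M.obsLaw x with hL
  set U := Obs.upperSV M.obsLaw x with hU
  have hLU : 0 < U - L := sub_pos.2 (hs1.trans hs2)
  obtain ⟨θ, hθ, hθ', hsθ⟩ : ∃ θ : ℝ, 0 < θ ∧ θ < 1 ∧ s = (1 - θ) * L + θ * U := by
    refine ⟨(s - L) / (U - L), div_pos (sub_pos.2 hs1) hLU,
      (div_lt_one hLU).2 (by linarith), ?_⟩
    field_simp
    ring
  have hac := hM.errLaw_ac
  have : NullSingletonClass (highPart M.errLaw (Obs.pHigh M.obsLaw)) :=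
    nullSingletonClass_map_fst_restrict hac _
  have : NullSingletonClass (lowPart M.errLaw (Obs.pLow M.obsLaw)) :=
    nullSingletonClass_map_fst_restrict hac _
  obtain ⟨φ, hφ, hφK, hφv⟩ := exists_rearrangement hM.isCompact_suppX (hM.continuousOn_ν₁ 0)
    (highPart M.errLaw (Obs.pHigh M.obsLaw)) (M.ν₁ 1 x) hθ hθ'
  -- The weight is `1 - θ` because the untreated mass enters the ATE with a minus sign, so its outer
  -- ray belongs to the lower bound.
  obtain ⟨ψ, hψ, hψK, hψv⟩ := exists_rearrangement hM.isCompact_suppX (hM.continuousOn_ν₁ 1)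
    (lowPart M.errLaw (Obs.pLow M.obsLaw)) (M.ν₁ 0 x) (θ := 1 - θ) (by linarith) (by linarith)
  have hT : Measurable (rearrange M.errLaw (Obs.pLow M.obsLaw) (Obs.pHigh M.obsLaw) φ ψ) :=
    measurable_rearrange hφ hψ
  obtain ⟨hac', hca'⟩ := map_rearrange_absolutelyContinuous (p := Obs.pLow M.obsLaw)
    (p' := Obs.pHigh M.obsLaw) hac hM.ac_errLaw hφ hψ
  have hA : (M.withErr _ hT).Assumptions := hM.withErr hac' hca'
  refine ⟨M.withErr _ hT, hA, hM.withErr_rearrange_obsLaw hφK hψK hT, ?_⟩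
  rw [hA.ATE_eq (by rwa [withErr_suppX]), withErr_errLaw]
  change (((M.errLaw.map _).map Prod.fst).real (Iio (M.ν₁ 1 x)))
    - ((M.errLaw.map _).map Prod.fst).real (Iio (M.ν₁ 0 x)) = s
  rw [map_rearrange_Iio_of_right hφ hψ (hψK x hx),
    map_rearrange_Iio_of_left hφ hψ hM.pLow_lt_pHigh.le (hφK x hx), hφv, hψv, hsθ, hL, hU,
    hM.lowerSV_eq hprod hx, hM.upperSV_eq hprod hx]
  ring

/-- The bounds and the support condition are functions of the observed law alone, so validity can be
applied inside the competing model. -/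
theorem identifiedSet_subset_Icc (hM : M.Assumptions) (hprod : Obs.ProductSupport M.obsLaw)
    {x : Vec k} (hx : x ∈ M.suppX) :
    identifiedSet M.obsLaw x ⊆ Icc (Obs.lowerSV M.obsLaw x) (Obs.upperSV M.obsLaw x) := by
  rintro _ ⟨N, hN, hNM, rfl⟩
  have hxN : x ∈ N.suppX := by rwa [← hN.obsLaw_suppX, hNM, hM.obsLaw_suppX]
  rw [← hNM] at hprod ⊢
  exact hN.ATE_mem_Icc hprod hxN

end Assumptions

end SVModel

theorem proposition1 {k l : ℕ} (M : SVModel.{u} k l) (hM : M.Assumptions)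
    (hprod : Obs.ProductSupport M.obsLaw) :
    -- sharpness
    (∀ x ∈ M.suppX, M.ATE x ∈ identifiedSet M.obsLaw x ∧
      AreSharpBounds (identifiedSet M.obsLaw x)
        (Obs.lowerSV M.obsLaw x) (Obs.upperSV M.obsLaw x)) ∧
    -- comparison with any model that shares `Ω_X`, `ν₁` and the law of `(ε₁, ε₂)`
    (∀ {l' : ℕ} (N : SVModel.{v} k l'), N.Assumptions → Obs.ProductSupport N.obsLaw →
      N.suppX = M.suppX → (∀ d, ∀ x ∈ M.suppX, N.ν₁ d x = M.ν₁ d x) → N.errLaw = M.errLaw →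
      Obs.pLow N.obsLaw ≤ Obs.pLow M.obsLaw → Obs.pHigh M.obsLaw ≤ Obs.pHigh N.obsLaw →
      ∀ x ∈ M.suppX,
        Obs.lowerSV M.obsLaw x ≤ Obs.lowerSV N.obsLaw x ∧
        Obs.upperSV N.obsLaw x ≤ Obs.upperSV M.obsLaw x ∧
        Obs.widthSV N.obsLaw x ≤ Obs.widthSV M.obsLaw x) := by
  refine ⟨fun x hx => ?_, fun N hN hprodN hsupp hν herr hlow hhigh x hx => ?_⟩
  · have hmem := hM.ATE_mem_identifiedSet hx
    exact ⟨hmem, ⟨_, hmem⟩, hM.identifiedSet_subset_Icc hprod hx,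
      hM.Ioo_subset_identifiedSet hprod hx⟩
  · obtain ⟨h1, h2⟩ := SVModel.bounds_mono_of_extreme_scores hM hprod hN hprodN hsupp hν herr
      hlow hhigh hx
    exact ⟨h1, h2, sub_le_sub h2 h1⟩
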